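/- Let $n,m\to\infty$ along a sequence, and let $p=p(m,n)\in(0,1]$, $c=c(m,n)>1$ satisfy $np=\Theta(1)$, $c=O(1)$, $mp\bigl(1-(1-p)^{n-1}\bigr)=c\ln n$ and $(c-1)\ln n\to\infty$. Let $\mathcal G$ be the binomial random intersection graph with $n$ vertices and $m$ attributes: each vertex has each attribute with probability $p$, independently of all other vertex-attribute pairs, and two distinct vertices are adjacent if and only if they share an attribute. Let $T=T(n,m)$ be positive integers with $T\to\infty$ and $T=o(\ln^3 n)$, and let $C_0>0$ be a constant. For a finite graph $H$ and a vertex $v$ of $H$, consider the simple random walk on $H$ started at $v$. Let $r_i$ be the probability that it is at $v$ at time $i$ (so $r_0=1$), put $R^H_{T,v}(z)=\sum_{i=0}^{T-1}r_iz^i$ for $z\in\mathbb C$, let $\tau_v\ge 1$ be the time of its first return to $v$, and put $\bar p^H_v=\Pr(\tau_v\le T-1)$. For $H=\mathcal G$ (with $\mathcal G$ given) write $R_{T,v}$ and $\bar p_v$. For two vertices $x,y$ of $\mathcal G$ with $\mathrm{dist}(x,y)\ge 20$, let $\mathcal G_\varkappa$ be the graph obtained from $\mathcal G$ by merging $x$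 and $y$ into one vertex $\varkappa$, put $\deg(\varkappa)=\deg(x)+\deg(y)$, and for $H=\mathcal G_\varkappa$ write $R_{T,x,y}=R^H_{T,\varkappa}$ and $\bar p_\varkappa=\bar p^H_\varkappa$. Then there is a constant $C>0$, which may depend on $C_0$ and on the given sequences but not on the index along the sequence nor on the realised graph, such that with probability tending to $1$ all of the following hold. (a) For every vertex $v$: $$\bigl||R_{T,v}(z)|-1\bigr|\le \frac{C}{\ln n}\quad\text{for all } |z|\le 1+(C_0T)^{-1},$$ $$\bigl|R_{T,v}(1)-(1+\bar p_v)\bigr|\le \frac{C}{\ln^2 n},\qquad \frac{1}{C\ln n}\le\bar p_v\le\frac{C}{\ln n}.$$ (b) For all vertices $x,y$ with $\mathrm{dist}(x,y)\ge 20$: $$\bigl||R_{T,x,y}(z)|-1\bigr|\le \frac{C}{\ln n}\quad\text{for all } |z|\le 1+(C_0T)^{-1},$$ $$\bigl|R_{T,x,y}(1)-(1+\bar p_\varkappa)\bigr|\le \frac{C}{\ln^2 n},\qquad \frac{1}{C\ln n}\le\bar p_\varkappa\le\frac{C}{\ln n},$$ $$\left|\frac{\deg(\varkappa)}{1+\bar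 p_\varkappa}-\frac{\deg(x)}{1+\bar p_x}-\frac{\deg(y)}{1+\bar p_y}\right|\le \frac{C\deg(\varkappa)}{\ln^2 n}.$$ -/

import Mathlib

open Filter Topology MeasureTheory

namespace IntersectionWalk

/-! ### The binomial random intersection graph -/

/-- A realised bipartite graph between `n` vertices and `m` attributes:
`b (v, w) = true` means that `v` is linked to (has) the attribute `w`. -/
abbrev Links (n m : ℕ) : Type := Fin n × Fin m → Bool

/-- The law of the random bipartite graph: every link is present with probability `p`,
independently of the others. -/
noncomputable def linkLaw (n m : ℕ) (p : unitInterval) : Measure (Links n m) :=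
  Measure.pi fun _ => ProbabilityTheory.bernoulliMeasure true false p

/-- The intersection graph defined by a bipartite graph: two distinct vertices are adjacent if and
only if they share an attribute. -/
def interGraph {n m : ℕ} (b : Links n m) : SimpleGraph (Fin n) where
  Adj u v := u ≠ v ∧ ∃ w : Fin m, b (u, w) = true ∧ b (v, w) = true
  symm := ⟨fun _ _ h => ⟨h.1.symm, h.2.imp fun _ hw => ⟨hw.2, hw.1⟩⟩⟩
  loopless := ⟨fun _ h => h.1 rfl⟩

/-! ### Simple random walk on a finite graph -/

section Walk

variable {V : Type} [Fintype V] (G : SimpleGraph V)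

open Classical in
/-- The degree of a vertex. -/
noncomputable def deg (v : V) : ℕ := G.degree v

open Classical in
/-- One-step transition probability of the simple random walk: from `u` the walk moves to a
uniformly random neighbour of `u`. -/
noncomputable def stepProb (u v : V) : ℝ := if G.Adj u v then 1 / (deg G u : ℝ) else 0

open Classical in
/-- Probability of the trajectory `ω 0, ω 1, …, ω N` for the first `N` steps of the simple random
walk started at `u`. -/
noncomputable def trajProb (u : V) (N : ℕ) (ω : Fin (N + 1) → V) : ℝ :=
  if ω 0 = u then ∏ i : Fin N, stepProb G (ω i.castSucc) (ω i.succ) else 0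

open Classical in
/-- Probability that the first `N` steps of the simple random walk started at `u` form a
trajectory belonging to `E`. -/
noncomputable def walkProb (u : V) (N : ℕ) (E : Set (Fin (N + 1) → V)) : ℝ :=
  ∑ ω : Fin (N + 1) → V, if ω ∈ E then trajProb G u N ω else 0

/-- The probability that the walk started at `v` is at `v` at time `i`. -/
noncomputable def returnProb (v : V) (i : ℕ) : ℝ :=
  walkProb G v i {ω | ω (Fin.last i) = v}

/-- `R_{T,v}(z) = ∑_{i=0}^{T-1} r_i z^i`, where `r_i` is the probability that the walk started at
`v` is at `v` at time `i`. -/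
noncomputable def returnGF (T : ℕ) (v : V) (z : ℂ) : ℂ :=
  ∑ i ∈ Finset.range T, (returnProb G v i : ℂ) * z ^ i

/-- `P(τ_v ≤ T - 1)`, where `τ_v ≥ 1` is the time of the first return to `v` of the walk started
at `v`. -/
noncomputable def firstReturnProb (T : ℕ) (v : V) : ℝ :=
  walkProb G v (T - 1) {ω | ∃ i : Fin (T - 1 + 1), 1 ≤ (i : ℕ) ∧ ω i = v}

end Walk

/-! ### Merging two vertices -/

/-- The vertex set after merging `x` and `y`: `none` is the merged vertex and the other vertices
are those different from `x` and `y`. -/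
abbrev MergedVertex {V : Type} (x y : V) : Type := Option {u : V // u ≠ x ∧ u ≠ y}

/-- The graph obtained from `G` by merging `x` and `y`. It is used for `x` and `y` that are neither
adjacent nor have a common neighbour, so that no loop or multiple edge arises. -/
def mergedGraph {V : Type} (G : SimpleGraph V) (x y : V) : SimpleGraph (MergedVertex x y) where
  Adj
    | none, none => False
    | none, some u => G.Adj x u ∨ G.Adj y u
    | some u, none => G.Adj x u ∨ G.Adj y u
    | some u, some v => G.Adj u v
  symm := ⟨by
    rintro (_ | u) (_ | v) h
    · exact h
    · exact h
    · exact h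
    · exact G.adj_symm h⟩
  loopless := ⟨by
    rintro (_ | u) h
    · exact h
    · exact G.irrefl h⟩

/-- The merged vertex. -/
def mergedPoint {V : Type} (x y : V) : MergedVertex x y := none

end IntersectionWalk

/-! Write L = ln n. The estimates follow, with explicit constants, from a short list of
deterministic properties (`IsTypical`, `IsTypical.estimates`), and these properties hold with
probability tending to 1 (`tendsto_linkLaw_not_isTypical`).

Walk. Let q be the first return probability within the horizon and S the expected number of returns.
The Markov property gives q ≤ S ≤ q(1 + S), so S = q + O(q²) when q ≤ 1/2 (`sum_returnProb_bounds`).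
On the given disc |z|^i is bounded for i < T, so R(z) differs from 1 by O(S). It remains to show
that q has order 1/L. For the lower bound, step to a neighbour and return at once; degrees are O(L).
For the upper bound, use the function ∑_{j<5} ρ^j 1[dist ≤ j] with ρ of order 1/L (`potential`). At
a vertex of degree of order L, boundedly many neighbours are closer to the target and at most a
quarter are not farther, so this function is superharmonic off the target up to ρ^5. Over T ≤ L³
steps the error is at most L³ρ^5 = O(L⁻²), which is the precision required.

A vertex is small if it shares fewer than εL attributes with other vertices. Superharmonicity can
fail at small vertices, but any two of them are at distance more than 10. So at most one, s, lies
near v apart from v itself, and it is added to the target.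

Local structure. Sets of at most 40 nodes of the bipartite graph span no more links than they have
nodes, so at most two links from a node can lead to a given place by short walks avoiding that node
(`LocallySparse.card_le_two`). This bounds the numbers of closer and of not farther neighbours.

Merging. Before the first return, the walk from the merged vertex is the original walk with target
{x, y}, and its first step is a degree-weighted mixture of steps from x and from y. Crossing between
x and y has probability O(L⁻²), so the merged return probability is the degree-weighted mean of the
two up to O(L⁻²). Expanding 1/(1 + q) to first order gives the degree identity.

Probability. Each bad event is handled by a union bound and a product moment, using that distinct
attributes are independent. Choosing a vertices and w attributes costs at most (np)^a (mp)^w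
p^{-(a+w)}, and the first two factors are polylogarithmic. An overfull set has a + w + 1 links, so a
factor p remains. A short connection between two small vertices has a + w − 1 links; this loses 1/p,
of order e^L, but smallness of both has probability about e^{-1.6L}. Isolated vertices contribute
e^{-(c-1)L}. -/

namespace IntersectionWalk

/-! ### Random walk: one-step recursions, hitting probabilities and numbers of returns -/

section WalkLemmas

variable {V : Type} [Fintype V] (G : SimpleGraph V)

/-- The expected value of `φ` after one step of the walk from `u`. -/
noncomputable def stepMean (φ : V → ℝ) (u : V) : ℝ := ∑ w, stepProb G u w * φ w

lemma stepProb_nonneg (u v : V) : 0 ≤ stepProb G u v := by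
  unfold stepProb; split_ifs <;> positivity

lemma stepMean_mono {φ ψ : V → ℝ} (h : ∀ w, φ w ≤ ψ w) (u : V) :
    stepMean G φ u ≤ stepMean G ψ u :=
  Finset.sum_le_sum fun w _ => mul_le_mul_of_nonneg_left (h w) (stepProb_nonneg G u w)

open Classical in
lemma stepMean_eq (φ : V → ℝ) (u : V) :
    stepMean G φ u = (∑ w ∈ G.neighborFinset u, φ w) / deg G u := by
  unfold stepMean stepProb
  rw [Finset.sum_div, ← Finset.sum_subset (Finset.subset_univ (G.neighborFinset u))]
  · refine Finset.sum_congr rfl fun w hw => ?_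
    rw [SimpleGraph.mem_neighborFinset] at hw
    rw [if_pos hw]; ring
  · intro w _ hw
    rw [SimpleGraph.mem_neighborFinset] at hw
    rw [if_neg hw, zero_mul]

lemma stepMean_nonneg {φ : V → ℝ} (h : ∀ w, 0 ≤ φ w) (u : V) : 0 ≤ stepMean G φ u :=
  Finset.sum_nonneg fun w _ => mul_nonneg (stepProb_nonneg G u w) (h w)

lemma stepMean_add (φ ψ : V → ℝ) (u : V) :
    stepMean G (fun w => φ w + ψ w) u = stepMean G φ u + stepMean G ψ u := by
  simp only [stepMean, mul_add, Finset.sum_add_distrib]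

lemma stepMean_mul_const (φ : V → ℝ) (a : ℝ) (u : V) :
    stepMean G (fun w => φ w * a) u = stepMean G φ u * a := by
  simp only [stepMean, Finset.sum_mul, mul_assoc]

lemma stepMean_sum {ι : Type*} (s : Finset ι) (φ : ι → V → ℝ) (u : V) :
    stepMean G (fun w => ∑ i ∈ s, φ i w) u = ∑ i ∈ s, stepMean G (φ i) u := by
  simp only [stepMean, Finset.mul_sum]
  exact Finset.sum_comm

open Classical in
lemma stepMean_const {u : V} (hu : 0 < deg G u) (a : ℝ) : stepMean G (fun _ => a) u = a := by
  rw [stepMean_eq, Finset.sum_const, SimpleGraph.card_neighborFinset_eq_degree]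
  change (deg G u • a) / _ = a
  rw [nsmul_eq_mul]
  have : (deg G u : ℝ) ≠ 0 := by positivity
  field_simp

/-- At an isolated vertex all step probabilities vanish and the mean is 0, so without a degree
hypothesis only an inequality holds. -/
lemma stepMean_const_le (u : V) {a : ℝ} (ha : 0 ≤ a) : stepMean G (fun _ => a) u ≤ a := by
  rcases Nat.eq_zero_or_pos (deg G u) with h | h
  · rw [stepMean_eq, h]; simpa using ha
  · rw [stepMean_const G h]

lemma walkProb_succ (u : V) (N : ℕ) (E : Set (Fin (N + 1 + 1) → V)) :
    walkProb G u (N + 1) E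
      = stepMean G (fun w => walkProb G w N {ω | (Fin.cons u ω : Fin (N + 1 + 1) → V) ∈ E}) u := by
  classical
  unfold walkProb stepMean
  rw [← (Fin.consEquiv (fun _ : Fin (N + 1 + 1) => V)).sum_comp, Fintype.sum_prod_type,
    Finset.sum_eq_single u]
  · simp_rw [Finset.mul_sum]
    rw [Finset.sum_comm]
    refine Finset.sum_congr rfl fun ω _ => ?_
    rw [Finset.sum_eq_single (ω 0)]
    · simp only [Fin.consEquiv_apply, Set.mem_ofPred_eq, trajProb, Fin.cons_zero, if_true]
      rw [Fin.prod_univ_succ]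
      simp only [Fin.castSucc_zero, Fin.cons_zero, Fin.cons_succ, ← Fin.succ_castSucc]
      change (if (Fin.cons u ω : Fin (N + 1 + 1) → V) ∈ E then _ else _) = _
      split_ifs <;> simp
    · intro w _ hw
      simp [trajProb, Ne.symm hw]
    · simp
  · intro w _ hw
    refine Finset.sum_eq_zero fun ω _ => ?_
    simp [trajProb, hw]
  · simp

lemma walkProb_zero (u : V) (E : Set (Fin (0 + 1) → V)) [Decidable ((fun _ => u) ∈ E)] :
    walkProb G u 0 E = if (fun _ => u) ∈ E then 1 else 0 := by
  classical
  unfold walkProb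
  rw [Finset.sum_eq_single (fun _ => u)]
  · simp [trajProb]
  · intro ω _ hω
    have : ω 0 ≠ u := fun h => hω (by ext i; rw [Fin.fin_one_eq_zero i, h])
    simp [trajProb, this]
  · simp

lemma walkProb_congr {u : V} {N : ℕ} {E F : Set (Fin (N + 1) → V)}
    (h : ∀ ω : Fin (N + 1) → V, ω 0 = u → (ω ∈ E ↔ ω ∈ F)) :
    walkProb G u N E = walkProb G u N F := by
  classical
  unfold walkProb
  refine Finset.sum_congr rfl fun ω _ => ?_
  by_cases h0 : ω 0 = u
  · simp [h ω h0]
  · simp [trajProb, h0]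

lemma walkProb_univ (hG : ∀ u, 0 < deg G u) (u : V) (N : ℕ) : walkProb G u N Set.univ = 1 := by
  classical
  induction N generalizing u with
  | zero => simp [walkProb_zero]
  | succ N ih =>
    rw [walkProb_succ]
    simp only [Set.mem_univ, Set.ofPred_true, ih]
    exact stepMean_const G (hG u) 1

open Classical in
/-- The probability that the walk started at `u` hits `A` by time `t`. -/
noncomputable def hitProb (A : Set V) : ℕ → V → ℝ
  | 0, u => if u ∈ A then 1 else 0
  | t + 1, u => if u ∈ A then 1 else stepMean G (hitProb A t) u

lemma hitProb_of_mem {A : Set V} {u : V} (hu : u ∈ A) (t : ℕ) : hitProb G A t u = 1 := by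
  cases t <;> simp [hitProb, hu]

lemma hitProb_zero_of_notMem {A : Set V} {u : V} (hu : u ∉ A) : hitProb G A 0 u = 0 := by
  simp [hitProb, hu]

lemma hitProb_succ_of_notMem {A : Set V} {u : V} (hu : u ∉ A) (t : ℕ) :
    hitProb G A (t + 1) u = stepMean G (hitProb G A t) u := by
  simp [hitProb, hu]

lemma hitProb_nonneg (A : Set V) (t : ℕ) (u : V) : 0 ≤ hitProb G A t u := by
  by_cases hu : u ∈ A
  · rw [hitProb_of_mem G hu]; exact zero_le_one
  induction t generalizing u with
  | zero => rw [hitProb_zero_of_notMem G hu]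
  | succ t ih =>
    rw [hitProb_succ_of_notMem G hu]
    refine stepMean_nonneg G (fun w => ?_) u
    by_cases hw : w ∈ A
    · rw [hitProb_of_mem G hw]; exact zero_le_one
    · exact ih w hw

lemma hitProb_mono {A B : Set V} (hAB : A ⊆ B) (t : ℕ) (u : V) :
    hitProb G A t u ≤ hitProb G B t u := by
  induction t generalizing u with
  | zero =>
    by_cases hu : u ∈ B
    · by_cases hA : u ∈ A <;> simp [hitProb, hu, hA]
    · simp [hitProb, hu, show u ∉ A from fun h => hu (hAB h)]
  | succ t ih =>
    by_cases hA : u ∈ A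
    · rw [hitProb_of_mem G hA, hitProb_of_mem G (hAB hA)]
    · rw [hitProb_succ_of_notMem G hA]
      by_cases hu : u ∈ B
      · rw [hitProb_of_mem G hu]
        refine (stepMean_mono G (ψ := fun _ => 1) (fun w => ?_) u).trans
          (stepMean_const_le G u zero_le_one)
        -- What remains is that hitting probabilities are at most 1, shown by a separate induction.
        refine (ih w).trans ?_
        clear ih
        induction t generalizing w with
        | zero => by_cases hw : w ∈ B <;> simp [hitProb, hw]
        | succ t ih =>
          by_cases hw : w ∈ B
          · rw [hitProb_of_mem G hw]
          · rw [hitProb_succ_of_notMem G hw]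
            exact (stepMean_mono G (ψ := fun _ => 1) ih w).trans
              (stepMean_const_le G w zero_le_one)
      · rw [hitProb_succ_of_notMem G hu]
        exact stepMean_mono G ih u

lemma hitProb_union_le (A B : Set V) (t : ℕ) (u : V) :
    hitProb G (A ∪ B) t u ≤ hitProb G A t u + hitProb G B t u := by
  have hA := hitProb_nonneg G A
  have hB := hitProb_nonneg G B
  by_cases hu : u ∈ A
  · rw [hitProb_of_mem G hu, hitProb_of_mem G (Or.inl hu)]
    linarith [hB t u]
  by_cases hu' : u ∈ B
  · rw [hitProb_of_mem G hu', hitProb_of_mem G (Or.inr hu')]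
    linarith [hA t u]
  have huu : u ∉ A ∪ B := by simp [hu, hu']
  induction t generalizing u with
  | zero => simp [hitProb, hu, hu']
  | succ t ih =>
    rw [hitProb_succ_of_notMem G huu, hitProb_succ_of_notMem G hu, hitProb_succ_of_notMem G hu',
      ← stepMean_add]
    refine stepMean_mono G (fun w => ?_) u
    by_cases hw : w ∈ A
    · rw [hitProb_of_mem G hw, hitProb_of_mem G (Or.inl hw)]
      linarith [hB t w]
    by_cases hw' : w ∈ B
    · rw [hitProb_of_mem G hw', hitProb_of_mem G (Or.inr hw')]
      linarith [hA t w]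
    exact ih w hw hw' (by simp [hw, hw'])

/-- A function that dominates the indicator of `A` and is superharmonic off `A` up to an error `δ`
controls hitting probabilities. -/
lemma hitProb_le_of_superharmonic {A : Set V} {f : V → ℝ} {δ : ℝ} (hδ : 0 ≤ δ)
    (h0 : ∀ u, 0 ≤ f u) (h1 : ∀ u ∈ A, 1 ≤ f u)
    (hf : ∀ u ∉ A, stepMean G f u ≤ f u + δ) (t : ℕ) (u : V) :
    hitProb G A t u ≤ f u + t * δ := by
  induction t generalizing u with
  | zero =>
    by_cases hu : u ∈ A
    · simpa [hitProb, hu] using h1 u hu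
    · simpa [hitProb, hu] using h0 u
  | succ t ih =>
    by_cases hu : u ∈ A
    · rw [hitProb_of_mem G hu]
      have := h1 u hu
      have h2 : 0 ≤ ((t + 1 : ℕ) : ℝ) * δ := by positivity
      linarith
    · rw [hitProb_succ_of_notMem G hu]
      have h := stepMean_mono G ih u
      rw [stepMean_add] at h
      have h2 := stepMean_const_le G u (a := t * δ) (by positivity)
      have h3 := hf u hu
      push_cast
      linarith

/-- The probability that the walk started at `u` is at `v` at time `i`. -/
noncomputable def visitProb (v : V) (i : ℕ) (u : V) : ℝ := walkProb G u i {ω | ω (Fin.last i) = v}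

lemma visitProb_succ (v : V) (i : ℕ) (u : V) :
    visitProb G v (i + 1) u = stepMean G (visitProb G v i) u := by
  unfold visitProb
  rw [walkProb_succ]
  simp only [Set.mem_ofPred_eq, ← Fin.succ_last, Fin.cons_succ]

open Classical in
lemma visitProb_zero (v u : V) : visitProb G v 0 u = if u = v then 1 else 0 := by
  unfold visitProb
  rw [walkProb_zero]
  simp

lemma visitProb_nonneg (v : V) (i : ℕ) (u : V) : 0 ≤ visitProb G v i u := by
  classical
  induction i generalizing u with
  | zero => rw [visitProb_zero]; split_ifs <;> norm_num
  | succ i ih => rw [visitProb_succ]; exact stepMean_nonneg G ih u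

/-- The expected number of visits to `v` at times `0, …, t` of the walk started at `u`. -/
noncomputable def visits (v : V) (t : ℕ) (u : V) : ℝ :=
  ∑ i ∈ Finset.range (t + 1), visitProb G v i u

lemma visits_succ (v : V) (t : ℕ) (u : V) :
    visits G v (t + 1) u = visitProb G v 0 u + stepMean G (visits G v t) u := by
  have : visits G v t = fun w => ∑ i ∈ Finset.range (t + 1), visitProb G v i w := rfl
  rw [this, stepMean_sum]
  unfold visits
  rw [Finset.sum_range_succ', add_comm]
  simp only [visitProb_succ]

lemma visits_mono (v u : V) (t : ℕ) : visits G v t u ≤ visits G v (t + 1) u := by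
  unfold visits
  rw [Finset.sum_range_succ _ (t + 1)]
  linarith [visitProb_nonneg G v (t + 1) u]

lemma one_le_visits (v : V) (t : ℕ) : 1 ≤ visits G v t v := by
  unfold visits
  rw [Finset.sum_range_succ']
  have := Finset.sum_nonneg fun i (_ : i ∈ Finset.range t) => visitProb_nonneg G v (i + 1) v
  simp only [visitProb_zero, if_true]
  linarith

lemma hitProb_le_visits (v : V) (t : ℕ) (u : V) : hitProb G {v} t u ≤ visits G v t u := by
  by_cases hu : u = v
  · rw [hitProb_of_mem G (Set.mem_singleton_iff.2 hu), hu]; exact one_le_visits G v t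
  induction t generalizing u with
  | zero => simp [hitProb, visits, hu, visitProb_zero]
  | succ t ih =>
    rw [hitProb_succ_of_notMem G (mt Set.mem_singleton_iff.1 hu), visits_succ, visitProb_zero, if_neg hu, zero_add]
    refine stepMean_mono G (fun w => ?_) u
    by_cases hw : w = v
    · rw [hitProb_of_mem G (Set.mem_singleton_iff.2 hw), hw]; exact one_le_visits G v t
    · exact ih w hw

/-- Strong Markov property: visits to `v` begin at the hitting time, and from then on at most `t`
steps remain. -/
lemma visits_le_hitProb_mul (v : V) (t : ℕ) (u : V) :
    visits G v t u ≤ hitProb G {v} t u * visits G v t v := by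
  by_cases hu : u = v
  · rw [hitProb_of_mem G (Set.mem_singleton_iff.2 hu), hu, one_mul]
  induction t generalizing u with
  | zero => simp [hitProb, visits, hu, visitProb_zero]
  | succ t ih =>
    rw [hitProb_succ_of_notMem G (mt Set.mem_singleton_iff.1 hu), visits_succ, visitProb_zero, if_neg hu, zero_add]
    have h1 : stepMean G (visits G v t) u
        ≤ stepMean G (fun w => hitProb G {v} t w * visits G v t v) u := by
      refine stepMean_mono G (fun w => ?_) u
      by_cases hw : w = v
      · rw [hitProb_of_mem G (Set.mem_singleton_iff.2 hw), hw, one_mul]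
      · exact ih w hw
    rw [stepMean_mul_const] at h1
    refine h1.trans (mul_le_mul_of_nonneg_left (visits_mono G v v t) ?_)
    exact stepMean_nonneg G (hitProb_nonneg G _ t) u

/-- Links the trajectory sum to the recursion. Positive degrees make the trajectories have total
mass 1, which is needed once `A` has been hit. -/
lemma walkProb_hit (hG : ∀ u, 0 < deg G u) (A : Set V) (t : ℕ) (u : V) :
    walkProb G u t {ω | ∃ i, ω i ∈ A} = hitProb G A t u := by
  by_cases hu : u ∈ A
  · rw [hitProb_of_mem G hu, ← walkProb_univ G hG u t]
    exact walkProb_congr G fun ω h => by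
      simp only [Set.mem_ofPred_eq, Set.mem_univ, iff_true]; exact ⟨0, h ▸ hu⟩
  induction t generalizing u with
  | zero =>
    classical
    rw [walkProb_zero, hitProb_zero_of_notMem G hu, if_neg]
    simpa using hu
  | succ t ih =>
    rw [hitProb_succ_of_notMem G hu, walkProb_succ]
    congr 1
    ext w
    simp only [Set.mem_ofPred_eq, Fin.exists_fin_succ, Fin.cons_zero, Fin.cons_succ, hu, false_or]
    by_cases hw : w ∈ A
    · rw [hitProb_of_mem G hw, ← walkProb_univ G hG w t]
      exact walkProb_congr G fun ω h => by
        simp only [Set.mem_ofPred_eq, Set.mem_univ, iff_true]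
        exact Or.inl (by rw [h]; exact hw)
    · simpa only [Fin.exists_fin_succ] using ih w hw

/-- With T = t + 2 the horizon T − 1 is one forced step away from `v` followed by `t` steps in which
to hit it. -/
lemma firstReturnProb_eq (hG : ∀ u, 0 < deg G u) (t : ℕ) (v : V) :
    firstReturnProb G (t + 2) v = stepMean G (hitProb G {v} t) v := by
  change walkProb G v (t + 1) {ω | ∃ i : Fin (t + 1 + 1), 1 ≤ (i : ℕ) ∧ ω i = v} = _
  rw [walkProb_succ]
  congr 1
  ext w
  rw [← walkProb_hit G hG]
  refine walkProb_congr G fun ω _ => ?_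
  simp only [Set.mem_ofPred_eq, Fin.exists_fin_succ (n := t + 1), Fin.cons_succ, Fin.val_zero,
    Fin.val_succ, Set.mem_singleton_iff]
  simp

lemma sum_returnProb (t : ℕ) (v : V) :
    ∑ i ∈ Finset.range (t + 2), returnProb G v i = 1 + stepMean G (visits G v t) v := by
  have h := visits_succ G v t v
  rw [visitProb_zero, if_pos rfl] at h
  exact h

/-- The number of returns by time `T - 1` is governed by the first return probability. -/
lemma sum_returnProb_bounds (hG : ∀ u, 0 < deg G u) (t : ℕ) (v : V)
    (hp : firstReturnProb G (t + 2) v ≤ 1 / 2) :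
    1 + firstReturnProb G (t + 2) v ≤ ∑ i ∈ Finset.range (t + 2), returnProb G v i ∧
    ∑ i ∈ Finset.range (t + 2), returnProb G v i ≤ 1 + 2 * firstReturnProb G (t + 2) v ∧
    ∑ i ∈ Finset.range (t + 2), returnProb G v i
      ≤ 1 + firstReturnProb G (t + 2) v + 2 * firstReturnProb G (t + 2) v ^ 2 := by
  have h1 : firstReturnProb G (t + 2) v ≤ stepMean G (visits G v t) v := by
    rw [firstReturnProb_eq G hG]
    exact stepMean_mono G (hitProb_le_visits G v t) v
  have h2 : stepMean G (visits G v t) v ≤ firstReturnProb G (t + 2) v * visits G v t v := by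
    rw [firstReturnProb_eq G hG, ← stepMean_mul_const]
    exact stepMean_mono G (visits_le_hitProb_mul G v t) v
  have h0 : 0 ≤ firstReturnProb G (t + 2) v := by
    rw [firstReturnProb_eq G hG]
    exact stepMean_nonneg G (hitProb_nonneg G _ t) v
  have h3 := visits_mono G v v t
  rw [visits_succ, visitProb_zero, if_pos rfl] at h3
  rw [sum_returnProb]
  set S := stepMean G (visits G v t) v
  set q := firstReturnProb G (t + 2) v
  -- Self-bounding inequality: with q ≤ 1/2 it gives S ≤ 2q, and inserting this back gives S ≤ q +
  -- 2q².
  have h4 : S ≤ q * (1 + S) := h2.trans (mul_le_mul_of_nonneg_left h3 h0)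
  have h5 : S ≤ 2 * q := by nlinarith
  refine ⟨by linarith, by linarith, by nlinarith⟩

lemma returnProb_nonneg (v : V) (i : ℕ) : 0 ≤ returnProb G v i := visitProb_nonneg G v i v

lemma returnGF_one (T : ℕ) (v : V) :
    returnGF G T v 1 = ((∑ i ∈ Finset.range T, returnProb G v i : ℝ) : ℂ) := by
  simp [returnGF]

lemma abs_norm_returnGF_sub_one_le (t : ℕ) (v : V) (z : ℂ) {M : ℝ}
    (hM : ∀ i < t + 2, ‖z‖ ^ i ≤ M) :
    |‖returnGF G (t + 2) v z‖ - 1|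
      ≤ M * (∑ i ∈ Finset.range (t + 2), returnProb G v i - 1) := by
  have h0 : returnProb G v 0 = 1 := by
    change visitProb G v 0 v = 1
    rw [visitProb_zero, if_pos rfl]
  have h1 : |‖returnGF G (t + 2) v z‖ - 1| ≤ ‖returnGF G (t + 2) v z - 1‖ := by
    simpa using abs_norm_sub_norm_le (returnGF G (t + 2) v z) 1
  refine h1.trans ?_
  unfold returnGF
  rw [Finset.sum_range_succ', Finset.sum_range_succ' (fun i => returnProb G v i), h0]
  simp only [Complex.ofReal_one, pow_zero, mul_one, add_sub_cancel_right]
  refine (norm_sum_le _ _).trans ?_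
  rw [Finset.mul_sum]
  refine Finset.sum_le_sum fun i hi => ?_
  rw [norm_mul, norm_pow, Complex.norm_real, Real.norm_of_nonneg (returnProb_nonneg G v _), mul_comm]
  refine mul_le_mul_of_nonneg_right (hM _ ?_) (returnProb_nonneg G v _)
  have := Finset.mem_range.1 hi
  omega

end WalkLemmas

/-! ### Merging two distant vertices -/

section Merge

variable {V : Type} {x y : V}

open Classical in
/-- The quotient map of the merging of `x` and `y`. -/
noncomputable def mergeMap (x y : V) (u : V) : MergedVertex x y :=
  if h : u ≠ x ∧ u ≠ y then some ⟨u, h⟩ else none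

lemma mergeMap_of_ne {u : V} (hx : u ≠ x) (hy : u ≠ y) :
    mergeMap x y u = some ⟨u, hx, hy⟩ := dif_pos ⟨hx, hy⟩

lemma mergeMap_eq_none_iff {u : V} : mergeMap x y u = none ↔ u = x ∨ u = y := by
  unfold mergeMap
  split_ifs with h
  · simpa using h
  · simpa [or_iff_not_imp_left] using h

/-- Only `x` and `y` are identified. A neighbourhood contains at most one of them when they have no
common neighbour, so degrees and one-step means survive the quotient. -/
lemma mergeMap_injOn {s : Set V} (hs : x ∉ s ∨ y ∉ s) : Set.InjOn (mergeMap x y) s := by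
  intro a ha b hb hab
  by_cases h : mergeMap x y a = none
  · have h' := hab ▸ h
    rw [mergeMap_eq_none_iff] at h h'
    rcases hs with hs | hs <;> rcases h with rfl | rfl <;> rcases h' with rfl | rfl <;>
      first | rfl | exact absurd ha hs | exact absurd hb hs
  · have h' := hab ▸ h
    rw [mergeMap_eq_none_iff, not_or] at h h'
    rw [mergeMap_of_ne h.1 h.2, mergeMap_of_ne h'.1 h'.2] at hab
    simpa using hab

variable [Fintype V] (G : SimpleGraph V)

open Classical in
lemma mergeMap_injOn_neighborFinset
    (hcommon : ∀ u, ¬ (G.Adj u x ∧ G.Adj u y)) (u : V) :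
    Set.InjOn (mergeMap x y) (G.neighborFinset u : Set V) := by
  refine mergeMap_injOn ?_
  simp only [SimpleGraph.coe_neighborFinset, SimpleGraph.mem_neighborSet]
  have := hcommon u
  tauto

variable [Fintype (MergedVertex x y)]

open Classical in
lemma neighborFinset_mergedGraph_some {u : V} (hx : u ≠ x) (hy : u ≠ y) :
    (mergedGraph G x y).neighborFinset (some ⟨u, hx, hy⟩)
      = (G.neighborFinset u).image (mergeMap x y) := by
  ext w
  rw [SimpleGraph.mem_neighborFinset, Finset.mem_image]
  simp only [SimpleGraph.mem_neighborFinset]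
  rcases w with _ | ⟨w, hwx, hwy⟩
  · change G.Adj x u ∨ G.Adj y u ↔ _
    simp only [mergeMap_eq_none_iff]
    constructor
    · rintro (h | h)
      · exact ⟨x, h.symm, Or.inl rfl⟩
      · exact ⟨y, h.symm, Or.inr rfl⟩
    · rintro ⟨w, h, rfl | rfl⟩
      · exact Or.inl h.symm
      · exact Or.inr h.symm
  · change G.Adj u w ↔ _
    constructor
    · exact fun h => ⟨w, h, mergeMap_of_ne hwx hwy⟩
    · rintro ⟨w', h, hw'⟩
      have : w' = w := by
        have h1 : ¬ (w' = x ∨ w' = y) := by rw [← mergeMap_eq_none_iff, hw']; simp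
        rw [not_or] at h1
        rw [mergeMap_of_ne h1.1 h1.2] at hw'
        simpa using hw'
      exact this ▸ h

open Classical in
lemma neighborFinset_mergedGraph_none (hxy : ¬ G.Adj x y) :
    (mergedGraph G x y).neighborFinset none
      = (G.neighborFinset x ∪ G.neighborFinset y).image (mergeMap x y) := by
  ext w
  rw [SimpleGraph.mem_neighborFinset, Finset.mem_image]
  simp only [SimpleGraph.mem_neighborFinset, Finset.mem_union]
  rcases w with _ | ⟨w, hwx, hwy⟩
  · change False ↔ _
    simp only [mergeMap_eq_none_iff, false_iff]
    rintro ⟨w, h | h, rfl | rfl⟩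
    · exact G.irrefl h
    · exact hxy h
    · exact hxy h.symm
    · exact G.irrefl h
  · change G.Adj x w ∨ G.Adj y w ↔ _
    constructor
    · exact fun h => ⟨w, h, mergeMap_of_ne hwx hwy⟩
    · rintro ⟨w', h, hw'⟩
      have : w' = w := by
        have h1 : ¬ (w' = x ∨ w' = y) := by rw [← mergeMap_eq_none_iff, hw']; simp
        rw [not_or] at h1
        rw [mergeMap_of_ne h1.1 h1.2] at hw'
        simpa using hw'
      exact this ▸ h

lemma deg_mergedGraph_some
    (hcommon : ∀ u, ¬ (G.Adj u x ∧ G.Adj u y)) {u : V} (hx : u ≠ x) (hy : u ≠ y) :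
    deg (mergedGraph G x y) (some ⟨u, hx, hy⟩) = deg G u := by
  classical
  unfold deg
  rw [← SimpleGraph.card_neighborFinset_eq_degree, ← SimpleGraph.card_neighborFinset_eq_degree,
    neighborFinset_mergedGraph_some G hx hy,
    Finset.card_image_of_injOn (mergeMap_injOn_neighborFinset G hcommon u)]

lemma stepMean_mergedGraph_some
    (hcommon : ∀ u, ¬ (G.Adj u x ∧ G.Adj u y)) (φ : MergedVertex x y → ℝ) {u : V} (hx : u ≠ x) (hy : u ≠ y) :
    stepMean (mergedGraph G x y) φ (some ⟨u, hx, hy⟩)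
      = stepMean G (fun w => φ (mergeMap x y w)) u := by
  classical
  rw [stepMean_eq, stepMean_eq, deg_mergedGraph_some G hcommon hx hy, neighborFinset_mergedGraph_some G hx hy,
    Finset.sum_image (mergeMap_injOn_neighborFinset G hcommon u)]

/-- Off the target the quotient map carries neighbourhoods bijectively to neighbourhoods, so both
sides satisfy the same recursion. -/
lemma hitProb_mergedGraph
    (hcommon : ∀ u, ¬ (G.Adj u x ∧ G.Adj u y)) (t : ℕ) (u : V) :
    hitProb (mergedGraph G x y) {none} t (mergeMap x y u) = hitProb G {x, y} t u := by
  induction t generalizing u with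
  | zero =>
    by_cases hu : u = x ∨ u = y
    · rw [hitProb_of_mem G (by simpa using hu), hitProb_of_mem _ (by
        simpa [mergeMap_eq_none_iff] using hu)]
    · rw [hitProb_zero_of_notMem G (by simpa using hu), hitProb_zero_of_notMem _ (by
        simpa [mergeMap_eq_none_iff] using hu)]
  | succ t ih =>
    by_cases hu : u = x ∨ u = y
    · rw [hitProb_of_mem G (by simpa using hu), hitProb_of_mem _ (by
        simpa [mergeMap_eq_none_iff] using hu)]
    · rw [hitProb_succ_of_notMem G (by simpa using hu), hitProb_succ_of_notMem _ (by
        simpa [mergeMap_eq_none_iff] using hu)]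
      rw [not_or] at hu
      rw [mergeMap_of_ne hu.1 hu.2, stepMean_mergedGraph_some G hcommon _ hu.1 hu.2]
      simp only [ih]

open Classical in
lemma sum_neighborFinset_mergedGraph_none
    (hxy : ¬ G.Adj x y) (hcommon : ∀ u, ¬ (G.Adj u x ∧ G.Adj u y)) (φ : MergedVertex x y → ℝ) :
    ∑ w ∈ (mergedGraph G x y).neighborFinset none, φ w
      = ∑ u ∈ G.neighborFinset x, φ (mergeMap x y u)
        + ∑ u ∈ G.neighborFinset y, φ (mergeMap x y u) := by
  rw [neighborFinset_mergedGraph_none G hxy, Finset.sum_image, Finset.sum_union]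
  · rw [Finset.disjoint_left]
    intro u h1 h2
    rw [SimpleGraph.mem_neighborFinset] at h1 h2
    exact hcommon u ⟨h1.symm, h2.symm⟩
  · refine mergeMap_injOn (Or.inl ?_)
    simp only [Finset.coe_union, SimpleGraph.coe_neighborFinset, Set.mem_union,
      SimpleGraph.mem_neighborSet]
    rintro (h | h)
    · exact G.irrefl h
    · exact hxy h.symm

lemma deg_mergedGraph_none
    (hxy : ¬ G.Adj x y) (hcommon : ∀ u, ¬ (G.Adj u x ∧ G.Adj u y)) : deg (mergedGraph G x y) none = deg G x + deg G y := by
  classical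
  have h := sum_neighborFinset_mergedGraph_none G hxy hcommon (fun _ => 1)
  simp only [Finset.sum_const, nsmul_eq_mul, mul_one, SimpleGraph.card_neighborFinset_eq_degree]
    at h
  exact_mod_cast h

lemma deg_mergedGraph_pos
    (hxy : ¬ G.Adj x y) (hcommon : ∀ u, ¬ (G.Adj u x ∧ G.Adj u y)) (hG : ∀ u, 0 < deg G u) (u : MergedVertex x y) :
    0 < deg (mergedGraph G x y) u := by
  rcases u with _ | ⟨u, hx, hy⟩
  · rw [deg_mergedGraph_none G hxy hcommon]; exact Nat.add_pos_left (hG x) _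
  · rw [deg_mergedGraph_some G hcommon hx hy]; exact hG u

/-- The neighbourhood of the merged vertex is the disjoint union of those of `x` and `y`, so a
uniform first step starts from `x` or `y` with weights proportional to the degrees. -/
lemma deg_mul_firstReturnProb_mergedGraph
    (hxy : ¬ G.Adj x y) (hcommon : ∀ u, ¬ (G.Adj u x ∧ G.Adj u y)) (hG : ∀ u, 0 < deg G u) (t : ℕ) :
    (deg G x + deg G y : ℝ) * firstReturnProb (mergedGraph G x y) (t + 2) (mergedPoint x y)
      = deg G x * stepMean G (hitProb G {x, y} t) x
        + deg G y * stepMean G (hitProb G {x, y} t) y := by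
  classical
  have hd := deg_mergedGraph_none G hxy hcommon
  have hx : (0 : ℝ) < deg G x := by exact_mod_cast hG x
  have hy : (0 : ℝ) < deg G y := by exact_mod_cast hG y
  rw [firstReturnProb_eq _ (deg_mergedGraph_pos G hxy hcommon hG), mergedPoint, stepMean_eq, hd,
    sum_neighborFinset_mergedGraph_none G hxy hcommon, stepMean_eq, stepMean_eq]
  simp only [hitProb_mergedGraph G hcommon]
  push_cast
  field_simp

end Merge

/-! ### The bipartite incidence graph and local sparsity -/

section Incidence

variable {n m : ℕ} (b : Links n m)

/-- The bipartite graph of vertices and attributes. -/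
def incidence : SimpleGraph (Fin n ⊕ Fin m) where
  Adj
    | .inl v, .inr w => b (v, w) = true
    | .inr w, .inl v => b (v, w) = true
    | _, _ => False
  symm := ⟨by
    rintro (v | w) (v' | w') h
    · exact h
    · exact h
    · exact h
    · exact h⟩
  loopless := ⟨by
    rintro (v | w) h
    · exact h
    · exact h⟩

open Classical in
/-- The links with both ends in `U`. -/
noncomputable def spannedLinks (U : Finset (Fin n ⊕ Fin m)) : Finset (Fin n × Fin m) :=
  Finset.univ.filter fun e => b e = true ∧ Sum.inl e.1 ∈ U ∧ Sum.inr e.2 ∈ U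

lemma mem_spannedLinks {U : Finset (Fin n ⊕ Fin m)} {e : Fin n × Fin m} :
    e ∈ spannedLinks b U ↔ b e = true ∧ Sum.inl e.1 ∈ U ∧ Sum.inr e.2 ∈ U := by
  simp [spannedLinks]

/-- The nodes `a` and `c` are the two ends of the link `e`. -/
def Joins (e : Fin n × Fin m) (a c : Fin n ⊕ Fin m) : Prop :=
  a = .inl e.1 ∧ c = .inr e.2 ∨ a = .inr e.2 ∧ c = .inl e.1

lemma exists_link_of_adj {a c : Fin n ⊕ Fin m} (h : (incidence b).Adj a c) :
    ∃ e : Fin n × Fin m, b e = true ∧ Joins e a c := by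
  rcases a with v | w <;> rcases c with v' | w'
  · exact h.elim
  · exact ⟨(v, w'), h, Or.inl ⟨rfl, rfl⟩⟩
  · exact ⟨(v', w), h, Or.inr ⟨rfl, rfl⟩⟩
  · exact h.elim

/-- A connected graph has at least as many edges as a spanning tree, and the links map onto the
edges of the induced bipartite graph. -/
lemma card_le_card_spannedLinks_add_one {U : Finset (Fin n ⊕ Fin m)}
    (hU : ((incidence b).induce (U : Set (Fin n ⊕ Fin m))).Connected) :
    U.card ≤ (spannedLinks b U).card + 1 := by
  have h := hU.card_vert_le_card_edgeSet_add_one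
  have h1 : Nat.card (U : Set (Fin n ⊕ Fin m)) = U.card := by simp
  rw [h1] at h
  refine h.trans (Nat.add_le_add_right ?_ 1)
  rw [← Nat.card_eq_finsetCard]
  let φ : spannedLinks b U → ((incidence b).induce (U : Set (Fin n ⊕ Fin m))).edgeSet := fun e =>
    ⟨s(⟨.inl e.1.1, ((mem_spannedLinks b).1 e.2).2.1⟩, ⟨.inr e.1.2, ((mem_spannedLinks b).1 e.2).2.2⟩),
      ((mem_spannedLinks b).1 e.2).1⟩
  refine Nat.card_le_card_of_surjective φ ?_
  rintro ⟨e, he⟩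
  induction e using Sym2.ind with
  | _ a c =>
    obtain ⟨a, ha⟩ := a
    obtain ⟨c, hc⟩ := c
    have hac : (incidence b).Adj a c := he
    obtain ⟨e, hbe, ⟨rfl, rfl⟩ | ⟨rfl, rfl⟩⟩ := exists_link_of_adj b hac
    · exact ⟨⟨e, (mem_spannedLinks b).2 ⟨hbe, ha, hc⟩⟩, rfl⟩
    · exact ⟨⟨e, (mem_spannedLinks b).2 ⟨hbe, hc, ha⟩⟩, Subtype.ext Sym2.eq_swap⟩

/-- Every set of at most `K` nodes spans at most as many links as it has elements. -/
def LocallySparse (K : ℕ) : Prop :=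
  ∀ U : Finset (Fin n ⊕ Fin m), U.card ≤ K → (spannedLinks b U).card ≤ U.card

variable {b}

/-- In a locally sparse bipartite graph, at most two neighbours of a node `a` are joined to a given
node by a short walk that avoids `a`. -/
lemma LocallySparse.card_le_two {K ℓ : ℕ} (hb : LocallySparse b K) (hK : 3 * (ℓ + 1) + 1 ≤ K)
    {a z : Fin n ⊕ Fin m} {N : Finset (Fin n ⊕ Fin m)}
    (hN : ∀ c ∈ N, (incidence b).Adj a c ∧
      ∃ q : (incidence b).Walk c z, q.length ≤ ℓ ∧ a ∉ q.support) :
    N.card ≤ 2 := by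
  classical
  by_contra! h
  obtain ⟨c₁, h₁, c₂, h₂, c₃, h₃, h12, h13, h23⟩ := Finset.two_lt_card.1 h
  obtain ⟨ha₁, q₁, hl₁, hq₁⟩ := hN c₁ h₁
  obtain ⟨ha₂, q₂, hl₂, hq₂⟩ := hN c₂ h₂
  obtain ⟨ha₃, q₃, hl₃, hq₃⟩ := hN c₃ h₃
  set U₀ : Finset (Fin n ⊕ Fin m) :=
    (q₁.support.toFinset ∪ q₂.support.toFinset) ∪ q₃.support.toFinset with hU₀
  -- The three walks all end at `z`, so their union is connected.
  have hconn : ((incidence b).induce (U₀ : Set (Fin n ⊕ Fin m))).Connected := by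
    have hset : (U₀ : Set (Fin n ⊕ Fin m))
        = ({v | v ∈ q₁.support} ∪ {v | v ∈ q₂.support}) ∪ {v | v ∈ q₃.support} := by
      ext v; simp [hU₀, or_assoc]
    rw [hset]
    refine SimpleGraph.induce_union_connected (SimpleGraph.induce_union_connected
      q₁.connected_induce_support.preconnected q₂.connected_induce_support.preconnected
      ⟨z, ?_, ?_⟩).preconnected q₃.connected_induce_support.preconnected ⟨z, ?_, ?_⟩
    · exact q₁.end_mem_support
    · exact q₂.end_mem_support
    · exact Or.inl q₁.end_mem_support
    · exact q₃.end_mem_support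
  have ha : a ∉ U₀ := by simp [hU₀, hq₁, hq₂, hq₃]
  have hcard : ∀ {c} (q : (incidence b).Walk c z), q.length ≤ ℓ →
      q.support.toFinset.card ≤ ℓ + 1 := fun q hq => by
    have := q.support.toFinset_card_le
    rw [SimpleGraph.Walk.length_support] at this
    omega
  have hU₀card : U₀.card ≤ 3 * (ℓ + 1) := by
    have := hcard q₁ hl₁
    have := hcard q₂ hl₂
    have := hcard q₃ hl₃
    rw [hU₀]
    have := Finset.card_union_le (q₁.support.toFinset ∪ q₂.support.toFinset) q₃.support.toFinset
    have := Finset.card_union_le q₁.support.toFinset q₂.support.toFinset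
    omega
  have hUcard : (insert a U₀).card = U₀.card + 1 := Finset.card_insert_of_notMem ha
  have hsp := hb (insert a U₀) (by omega)
  have htree := card_le_card_spannedLinks_add_one b hconn
  have hmem : ∀ {c} (q : (incidence b).Walk c z), q.support.toFinset ⊆ U₀ → c ∈ U₀ :=
    fun q hq => hq (by simp)
  have hc₁ : c₁ ∈ U₀ := hmem q₁ (by intro v hv; simp only [hU₀, Finset.mem_union]; tauto)
  have hc₂ : c₂ ∈ U₀ := hmem q₂ (by intro v hv; simp only [hU₀, Finset.mem_union]; tauto)
  have hc₃ : c₃ ∈ U₀ := hmem q₃ (by intro v hv; simp only [hU₀, Finset.mem_union]; tauto)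
  obtain ⟨e₁, hb₁, he₁⟩ := exists_link_of_adj b ha₁
  obtain ⟨e₂, hb₂, he₂⟩ := exists_link_of_adj b ha₂
  obtain ⟨e₃, hb₃, he₃⟩ := exists_link_of_adj b ha₃
  have hne : ∀ {c c' : Fin n ⊕ Fin m} {e e'}, c ≠ c' → Joins e a c → Joins e' a c' → e ≠ e' := by
    rintro c c' e e' hcc h h' rfl
    rcases h with ⟨h1, rfl⟩ | ⟨h1, rfl⟩ <;> rcases h' with ⟨h2, rfl⟩ | ⟨h2, rfl⟩ <;> simp_all
  have hnot : ∀ {c e}, Joins e a c → e ∉ spannedLinks b U₀ := by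
    rintro c e (⟨h, -⟩ | ⟨h, -⟩) he <;> rw [mem_spannedLinks] at he
    · exact ha (h ▸ he.2.1)
    · exact ha (h ▸ he.2.2)
  have hin : ∀ {c e}, b e = true → c ∈ U₀ → Joins e a c →
      e ∈ spannedLinks b (insert a U₀) := by
    rintro c e hbe hc (⟨h, h'⟩ | ⟨h, h'⟩) <;> rw [mem_spannedLinks, ← h, ← h'] <;>
      simp [hbe, hc]
  -- `U₀` spans at least |U₀| − 1 links and `a` adds three new ones: |U₀| + 2 links on |U₀| + 1
  -- nodes, against sparsity.
  have hsub : insert e₁ (insert e₂ (insert e₃ (spannedLinks b U₀))) ⊆ spannedLinks b (insert a U₀) := by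
    intro e he
    simp only [Finset.mem_insert] at he
    rcases he with rfl | rfl | rfl | he
    · exact hin hb₁ hc₁ he₁
    · exact hin hb₂ hc₂ he₂
    · exact hin hb₃ hc₃ he₃
    · rw [mem_spannedLinks] at he ⊢
      exact ⟨he.1, Finset.mem_insert_of_mem he.2.1, Finset.mem_insert_of_mem he.2.2⟩
  have hle := Finset.card_le_card hsub
  rw [Finset.card_insert_of_notMem, Finset.card_insert_of_notMem, Finset.card_insert_of_notMem] at hle
  · omega
  · exact hnot he₃
  · simp only [Finset.mem_insert, not_or]
    exact ⟨hne h23 he₂ he₃, hnot he₂⟩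
  · simp only [Finset.mem_insert, not_or]
    exact ⟨hne h12 he₁ he₂, hne h13 he₁ he₃, hnot he₁⟩

end Incidence

/-! ### Balls around a set -/

section Growth

variable {V : Type} (G : SimpleGraph V)

/-- The vertices at distance less than `j` from `S`. -/
def nearSet (S : Set V) : ℕ → Set V
  | 0 => ∅
  | j + 1 => S ∪ {u | ∃ w ∈ nearSet S j, u = w ∨ G.Adj u w}

variable {G}

lemma nearSet_mono_succ (S : Set V) (j : ℕ) : nearSet G S j ⊆ nearSet G S (j + 1) :=
  fun u hu => Or.inr ⟨u, hu, Or.inl rfl⟩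

lemma nearSet_mono (S : Set V) {i j : ℕ} (h : i ≤ j) : nearSet G S i ⊆ nearSet G S j :=
  monotone_nat_of_le_succ (nearSet_mono_succ S) h

lemma subset_nearSet_succ (S : Set V) (j : ℕ) : S ⊆ nearSet G S (j + 1) := fun _ hu => Or.inl hu

lemma nearSet_succ_of_adj {S : Set V} {j : ℕ} {u w : V} (h : G.Adj u w) (hw : w ∈ nearSet G S j) :
    u ∈ nearSet G S (j + 1) := Or.inr ⟨w, hw, Or.inr h⟩

lemma exists_edist_le_of_mem_nearSet {S : Set V} {j : ℕ} {u : V} (hu : u ∈ nearSet G S (j + 1)) :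
    ∃ z ∈ S, G.edist u z ≤ j := by
  induction j generalizing u with
  | zero =>
    rcases hu with hu | ⟨w, hw, -⟩
    · exact ⟨u, hu, by simp⟩
    · exact hw.elim
  | succ j ih =>
    rcases hu with hu | ⟨w, hw, rfl | hw'⟩
    · exact ⟨u, hu, by simp⟩
    · obtain ⟨z, hz, h⟩ := ih hw
      exact ⟨z, hz, h.trans (by push_cast; exact le_self_add)⟩
    · obtain ⟨z, hz, h⟩ := ih hw
      refine ⟨z, hz, (SimpleGraph.edist_triangle (v := w)).trans ?_⟩
      rw [SimpleGraph.edist_eq_one_iff_adj.2 hw', add_comm]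
      push_cast
      exact add_le_add_left h 1

end Growth

/-! ### How many neighbours of a vertex are closer or equally close to a target -/

section Incidence

variable {n m : ℕ} {b : Links n m}

/-- A set of neighbours of `u` with short connections to `z` avoiding `u` is at most twice as large
as its largest part inside an attribute of `u`. -/
lemma LocallySparse.card_neighbors_le {K ℓ M : ℕ} (hb : LocallySparse b K)
    (hK : 3 * (ℓ + 2) + 1 ≤ K) {u : Fin n} {z : Fin n ⊕ Fin m} {N : Finset (Fin n)}
    (hN : ∀ y ∈ N, (interGraph b).Adj u y ∧
      ∃ q : (incidence b).Walk (.inl y) z, q.length ≤ ℓ ∧ .inl u ∉ q.support)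
    (hM : ∀ w, b (u, w) = true → (N.filter fun y => b (y, w) = true).card ≤ M) :
    N.card ≤ 2 * M := by
  classical
  -- The attributes of `u` through which `N` is reached. Each continues through some `y` to `z`
  -- without meeting `u`, so there are at most two, each containing at most `M` elements of `N`.
  set W : Finset (Fin m) :=
    Finset.univ.filter fun w => b (u, w) = true ∧ ∃ y ∈ N, b (y, w) = true with hW
  have hW2 : W.card ≤ 2 := by
    rw [← Finset.card_image_of_injective W (Sum.inr_injective (α := Fin n))]
    refine hb.card_le_two (a := .inl u) (z := z) (ℓ := ℓ + 1) hK fun c hc => ?_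
    obtain ⟨w, hw, rfl⟩ := Finset.mem_image.1 hc
    obtain ⟨huw, y, hy, hyw⟩ := (Finset.mem_filter.1 hw).2
    obtain ⟨-, q, hq, huq⟩ := hN y hy
    have hadj : (incidence b).Adj (.inr w) (.inl y) := hyw
    refine ⟨huw, SimpleGraph.Walk.cons hadj q, ?_, ?_⟩
    · rw [SimpleGraph.Walk.length_cons]; omega
    · rw [SimpleGraph.Walk.support_cons, List.mem_cons, not_or]
      exact ⟨Sum.inl_ne_inr, huq⟩
  have hsub : N ⊆ W.biUnion fun w => N.filter fun y => b (y, w) = true := by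
    intro y hy
    obtain ⟨⟨-, w, huw, hyw⟩, -⟩ := hN y hy
    exact Finset.mem_biUnion.2 ⟨w, Finset.mem_filter.2 ⟨Finset.mem_univ _, huw, y, hy, hyw⟩,
      Finset.mem_filter.2 ⟨hy, hyw⟩⟩
  calc N.card ≤ _ := Finset.card_le_card hsub
    _ ≤ W.card * M := Finset.card_biUnion_le_card_mul _ _ _ fun w hw =>
        hM w (Finset.mem_filter.1 hw).2.1
    _ ≤ 2 * M := Nat.mul_le_mul_right M hW2

/-- A geodesic towards `S` stays, after its start, in the smaller ball. Recording this for vertices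
and for attributes is what later shows that the walk avoids a vertex outside the ball, and also the
attributes of that vertex. -/
lemma exists_walk_of_mem_nearSet {S : Set (Fin n)} {j : ℕ} {y : Fin n}
    (hy : y ∈ nearSet (interGraph b) S (j + 1)) :
    ∃ z ∈ S, ∃ q : (incidence b).Walk (.inl y) (.inl z), q.length ≤ 2 * j ∧
      (∀ x, .inl x ∈ q.support → x = y ∨ x ∈ nearSet (interGraph b) S j) ∧
      ∀ w, .inr w ∈ q.support → ∃ x ∈ nearSet (interGraph b) S j, b (x, w) = true := by
  induction j generalizing y with
  | zero =>
    rcases hy with hy | ⟨w, hw, -⟩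
    · refine ⟨y, hy, SimpleGraph.Walk.nil, by simp, ?_, ?_⟩ <;> simp
    · exact hw.elim
  | succ j ih =>
    rcases hy with hy | ⟨y', hy', rfl | hyy'⟩
    · refine ⟨y, hy, SimpleGraph.Walk.nil, by simp, ?_, ?_⟩ <;> simp
    · obtain ⟨z, hz, q, hq, h1, h2⟩ := ih hy'
      refine ⟨z, hz, q, by omega, fun x hx => (h1 x hx).imp id fun h => nearSet_mono_succ _ _ h,
        fun w hw => ?_⟩
      obtain ⟨x, hx, hxw⟩ := h2 w hw
      exact ⟨x, nearSet_mono_succ _ _ hx, hxw⟩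
    · obtain ⟨z, hz, q, hq, h1, h2⟩ := ih hy'
      obtain ⟨-, t, hyt, hyt'⟩ := hyy'
      have ha1 : (incidence b).Adj (.inl y) (.inr t) := hyt
      have ha2 : (incidence b).Adj (.inr t) (.inl y') := hyt'
      refine ⟨z, hz, .cons ha1 (.cons ha2 q), ?_, ?_, ?_⟩
      · simp only [SimpleGraph.Walk.length_cons]; omega
      · intro x hx
        simp only [SimpleGraph.Walk.support_cons, List.mem_cons, Sum.inl.injEq, reduceCtorEq,
          false_or] at hx
        rcases hx with rfl | hx
        · exact Or.inl rfl
        · rcases h1 x hx with rfl | h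
          · exact Or.inr hy'
          · exact Or.inr (nearSet_mono_succ _ _ h)
      · intro w hw
        simp only [SimpleGraph.Walk.support_cons, List.mem_cons, Sum.inr.injEq, reduceCtorEq,
          false_or] at hw
        rcases hw with rfl | hw
        · exact ⟨y', hy', hyt'⟩
        · obtain ⟨x, hx, hxw⟩ := h2 w hw
          exact ⟨x, nearSet_mono_succ _ _ hx, hxw⟩

open Classical in
/-- A vertex has a bounded number of neighbours that are closer to `{v, s}`. -/
lemma LocallySparse.card_closer_le {K j : ℕ} (hb : LocallySparse b K)
    (hK : 3 * (2 * j + 2) + 1 ≤ K) {u v s : Fin n}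
    (hu : u ∉ nearSet (interGraph b) {v, s} (j + 1)) :
    (((interGraph b).neighborFinset u).filter
      (· ∈ nearSet (interGraph b) {v, s} (j + 1))).card ≤ 8 := by
  set G := interGraph b
  -- Avoiding the attributes of `u` as well lets sparsity be applied a second time, at an attribute:
  -- at most two attributes of `u`, and at most two vertices in each. With two possible endpoints
  -- this gives 8.
  let N : Fin n → Finset (Fin n) := fun z => (G.neighborFinset u).filter fun y =>
    ∃ q : (incidence b).Walk (.inl y) (.inl z), q.length ≤ 2 * j ∧ .inl u ∉ q.support ∧
      ∀ w, b (u, w) = true → .inr w ∉ q.support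
  have hN : ∀ z, (N z).card ≤ 2 * 2 := by
    intro z
    refine hb.card_neighbors_le hK (u := u) (z := .inl z) (fun y hy => ?_) fun w hw => ?_
    · obtain ⟨hy, q, hq, huq, -⟩ := Finset.mem_filter.1 hy
      exact ⟨(G.mem_neighborFinset u y).1 hy, q, hq, huq⟩
    · rw [← Finset.card_image_of_injective _ (Sum.inl_injective (β := Fin m))]
      refine hb.card_le_two (a := .inr w) (z := .inl z) (ℓ := 2 * j) (by omega) fun c hc => ?_
      obtain ⟨y, hy, rfl⟩ := Finset.mem_image.1 hc
      obtain ⟨hy, hyw⟩ := Finset.mem_filter.1 hy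
      obtain ⟨-, q, hq, -, hwq⟩ := Finset.mem_filter.1 hy
      exact ⟨hyw, q, hq, hwq w hw⟩
  have hsub : (G.neighborFinset u).filter (· ∈ nearSet G {v, s} (j + 1)) ⊆ N v ∪ N s := by
    intro y hy
    obtain ⟨hy, hyn⟩ := Finset.mem_filter.1 hy
    obtain ⟨z, hz, q, hq, h1, h2⟩ := exists_walk_of_mem_nearSet hyn
    have hyz : y ∈ N z := by
      refine Finset.mem_filter.2 ⟨hy, q, hq, fun hx => ?_, fun w huw hw => ?_⟩
      · rcases h1 u hx with rfl | h
        · exact hu hyn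
        · exact hu (nearSet_mono_succ _ _ h)
      -- An attribute of `u` on the walk would contain a vertex of the smaller ball and so bring `u`
      -- into the ball of radius `j`.
      · obtain ⟨x, hx, hxw⟩ := h2 w hw
        by_cases hux : u = x
        · exact hu (nearSet_mono_succ _ _ (hux ▸ hx))
        · exact hu (nearSet_succ_of_adj ⟨hux, w, huw, hxw⟩ hx)
    rcases hz with rfl | rfl
    · exact Finset.mem_union_left _ hyz
    · exact Finset.mem_union_right _ hyz
  have := Finset.card_le_card hsub
  have := Finset.card_union_le (N v) (N s)
  have := hN v
  have := hN s
  omega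

open Classical in
/-- A vertex has few neighbours at the same distance from `{v, s}`. -/
lemma LocallySparse.card_not_farther_le {K j M : ℕ} (hb : LocallySparse b K)
    (hK : 3 * (2 * (j + 1) + 2) + 1 ≤ K)
    (hM : ∀ w, (Finset.univ.filter fun y => b (y, w) = true).card ≤ M) {u v s : Fin n}
    (hu : u ∉ nearSet (interGraph b) {v, s} (j + 1)) :
    (((interGraph b).neighborFinset u).filter
      (· ∈ nearSet (interGraph b) {v, s} (j + 2))).card ≤ 4 * M := by
  set G := interGraph b
  -- Here the walk may use an attribute of `u`, as `u` itself may be at the same distance; hence the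
  -- size bound `M` replaces the count of two per attribute.
  let N : Fin n → Finset (Fin n) := fun z => (G.neighborFinset u).filter fun y =>
    ∃ q : (incidence b).Walk (.inl y) (.inl z), q.length ≤ 2 * (j + 1) ∧ .inl u ∉ q.support
  have hN : ∀ z, (N z).card ≤ 2 * M := by
    intro z
    refine hb.card_neighbors_le hK (u := u) (z := .inl z) (fun y hy => ?_) fun w hw => ?_
    · obtain ⟨hy, q, hq, huq⟩ := Finset.mem_filter.1 hy
      exact ⟨(G.mem_neighborFinset u y).1 hy, q, hq, huq⟩
    · exact (Finset.card_le_card (Finset.filter_subset_filter _ (Finset.subset_univ _))).trans (hM w)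
  have hsub : (G.neighborFinset u).filter (· ∈ nearSet G {v, s} (j + 2)) ⊆ N v ∪ N s := by
    intro y hy
    obtain ⟨hy, hyn⟩ := Finset.mem_filter.1 hy
    obtain ⟨z, hz, q, hq, h1, h2⟩ := exists_walk_of_mem_nearSet hyn
    have hyz : y ∈ N z := by
      refine Finset.mem_filter.2 ⟨hy, q, hq, fun hx => ?_⟩
      rcases h1 u hx with rfl | h
      · exact G.irrefl ((G.mem_neighborFinset u u).1 hy)
      · exact hu h
    rcases hz with rfl | rfl
    · exact Finset.mem_union_left _ hyz
    · exact Finset.mem_union_right _ hyz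
  have := Finset.card_le_card hsub
  have := Finset.card_union_le (N v) (N s)
  have := hN v
  have := hN s
  omega

variable (b) in
open Classical in
/-- The number of attributes that `v` shares with some other vertex. -/
noncomputable def sharedAttrs (v : Fin n) : ℕ :=
  (Finset.univ.filter fun w => b (v, w) = true ∧ ∃ u, u ≠ v ∧ b (u, w) = true).card

/-- A neighbour shares at most two attributes with `v`. So many shared attributes force a large
degree; shared attributes are used to define smallness because independence across attributes makes
them easy to count. -/
lemma LocallySparse.sharedAttrs_le {K : ℕ} (hb : LocallySparse b K) (hK : 7 ≤ K) (v : Fin n) :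
    sharedAttrs b v ≤ 2 * deg (interGraph b) v := by
  classical
  set G := interGraph b
  have hsub : (Finset.univ.filter fun w => b (v, w) = true ∧ ∃ u, u ≠ v ∧ b (u, w) = true)
      ⊆ (G.neighborFinset v).biUnion fun u =>
        Finset.univ.filter fun w => b (v, w) = true ∧ b (u, w) = true := by
    intro w hw
    obtain ⟨hvw, u, huv, huw⟩ := (Finset.mem_filter.1 hw).2
    refine Finset.mem_biUnion.2 ⟨u, ?_, Finset.mem_filter.2 ⟨Finset.mem_univ _, hvw, huw⟩⟩
    rw [SimpleGraph.mem_neighborFinset]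
    exact ⟨huv.symm, w, hvw, huw⟩
  have hle := (Finset.card_le_card hsub).trans (Finset.card_biUnion_le_card_mul _ _ 2 fun u hu => ?_)
  · rw [SimpleGraph.card_neighborFinset_eq_degree, mul_comm] at hle
    unfold sharedAttrs deg
    convert hle
  · rw [SimpleGraph.mem_neighborFinset] at hu
    rw [← Finset.card_image_of_injective _ (Sum.inr_injective (α := Fin n))]
    refine hb.card_le_two (a := .inl v) (z := .inl u) (ℓ := 1) hK fun c hc => ?_
    obtain ⟨w, hw, rfl⟩ := Finset.mem_image.1 hc
    obtain ⟨hvw, huw⟩ := (Finset.mem_filter.1 hw).2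
    have hadj : (incidence b).Adj (.inr w) (.inl u) := huw
    refine ⟨hvw, .cons hadj .nil, by simp, ?_⟩
    simpa using hu.1

end Incidence

/-! ### The potential: a weighted sum of five balls -/

section Potential

variable {V : Type} (G : SimpleGraph V)

open Classical in
/-- A weighted sum of indicators of balls around `S`. -/
noncomputable def potential (S : Set V) (ρ : ℝ) (u : V) : ℝ :=
  ∑ j ∈ Finset.range 5, ρ ^ j * if u ∈ nearSet G S (j + 1) then 1 else 0

variable {G}

lemma potential_nonneg (S : Set V) {ρ : ℝ} (hρ : 0 ≤ ρ) (u : V) : 0 ≤ potential G S ρ u :=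
  Finset.sum_nonneg fun j _ => mul_nonneg (pow_nonneg hρ j) (by split_ifs <;> norm_num)

lemma one_le_potential {S : Set V} {ρ : ℝ} (hρ : 0 ≤ ρ) {u : V} (hu : u ∈ S) :
    1 ≤ potential G S ρ u := by
  classical
  unfold potential
  rw [Finset.sum_range_succ', if_pos (subset_nearSet_succ S 0 hu)]
  have : 0 ≤ ∑ j ∈ Finset.range 4,
      ρ ^ (j + 1) * if u ∈ nearSet G S (j + 1 + 1) then (1 : ℝ) else 0 :=
    Finset.sum_nonneg fun j _ => mul_nonneg (pow_nonneg hρ _) (by split_ifs <;> norm_num)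
  linarith

lemma potential_le_five (S : Set V) {ρ : ℝ} (hρ : 0 ≤ ρ) (hρ1 : ρ ≤ 1) (u : V) :
    potential G S ρ u ≤ 5 := by
  classical
  have : potential G S ρ u ≤ ∑ j ∈ Finset.range 5, (1 : ℝ) :=
    Finset.sum_le_sum fun j _ => mul_le_one₀ (pow_le_one₀ hρ hρ1) (by split_ifs <;> norm_num)
      (by split_ifs <;> norm_num)
  simpa using this

lemma potential_le_of_notMem {S : Set V} {ρ : ℝ} (hρ : 0 ≤ ρ) (hρ1 : ρ ≤ 1) {u : V} (hu : u ∉ S) :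
    potential G S ρ u ≤ 4 * ρ := by
  classical
  have h1 : u ∉ nearSet G S (0 + 1) := by
    rintro (h | ⟨w, hw, -⟩)
    · exact hu h
    · exact hw
  unfold potential
  rw [Finset.sum_range_succ', if_neg h1, mul_zero, add_zero]
  have : ∑ j ∈ Finset.range 4, (ρ ^ (j + 1) * if u ∈ nearSet G S (j + 1 + 1) then (1 : ℝ) else 0)
      ≤ ∑ j ∈ Finset.range 4, ρ :=
    Finset.sum_le_sum fun j _ => by
      have h2 : ρ ^ (j + 1) ≤ ρ := by
        rw [pow_succ]; exact mul_le_of_le_one_left hρ (pow_le_one₀ hρ hρ1)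
      have h3 : 0 ≤ ρ ^ (j + 1) := pow_nonneg hρ _
      split_ifs <;> linarith
  simpa using this

lemma potential_eq_zero {S : Set V} {ρ : ℝ} {u : V} (hu : u ∉ nearSet G S 5) :
    potential G S ρ u = 0 := by
  classical
  refine Finset.sum_eq_zero fun j hj => ?_
  have : j + 1 ≤ 5 := Finset.mem_range.1 hj
  rw [if_neg fun h => hu (nearSet_mono S this h), mul_zero]

end Potential

/-! ### Near superharmonicity of the potential -/

section Superharmonic

variable {V : Type} [Fintype V] (G : SimpleGraph V)

open Classical in
lemma stepMean_indicator (A : Set V) (u : V) :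
    stepMean G (fun w => if w ∈ A then 1 else 0) u
      = ((G.neighborFinset u).filter (· ∈ A)).card / (deg G u : ℝ) := by
  rw [stepMean_eq, Finset.sum_boole]

open Classical in
lemma stepMean_indicator_le_one (A : Set V) (u : V) :
    stepMean G (fun w => if w ∈ A then 1 else 0) u ≤ 1 :=
  (stepMean_mono G (ψ := fun _ => 1) (fun w => by split_ifs <;> norm_num) u).trans
    (stepMean_const_le G u zero_le_one)

open Classical in
lemma stepMean_indicator_eq_zero {A : Set V} {u : V} (h : ∀ w, G.Adj u w → w ∉ A) :
    stepMean G (fun w => if w ∈ A then 1 else 0) u = 0 := by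
  rw [stepMean_indicator, Finset.filter_false_of_mem, Finset.card_empty, Nat.cast_zero, zero_div]
  intro w hw
  exact h w ((G.mem_neighborFinset u w).1 hw)

variable {G}

open Classical in
lemma stepMean_potential (S : Set V) (ρ : ℝ) (u : V) :
    stepMean G (potential G S ρ) u = ∑ j ∈ Finset.range 5,
      ρ ^ j * stepMean G (fun w => if w ∈ nearSet G S (j + 1) then 1 else 0) u := by
  unfold potential
  rw [stepMean_sum]
  refine Finset.sum_congr rfl fun j _ => ?_
  simp only [mul_comm (ρ ^ j)]
  rw [← stepMean_mul_const]

open Classical in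
/-- The potential is almost superharmonic off `S` if few neighbours are closer to `S`. -/
lemma stepMean_potential_le {S : Set V} {ρ : ℝ} (hρ : 0 ≤ ρ) {u : V} (hu : u ∉ S)
    (hcl : u ∈ nearSet G S 6 → ∀ d ∈ Finset.range 5, u ∉ nearSet G S (d + 1) →
      stepMean G (fun w => if w ∈ nearSet G S (d + 1) then 1 else 0) u ≤ ρ / 4)
    (heq : u ∈ nearSet G S 6 → ∀ d ∈ Finset.range 4, u ∉ nearSet G S (d + 1) →
      stepMean G (fun w => if w ∈ nearSet G S (d + 2) then 1 else 0) u ≤ 1 / 4) :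
    stepMean G (potential G S ρ) u ≤ potential G S ρ u + ρ ^ 5 := by
  have hzero : ∀ j, u ∉ nearSet G S (j + 1 + 1) →
      stepMean G (fun w => if w ∈ nearSet G S (j + 1) then 1 else 0) u = 0 := fun j hj =>
    stepMean_indicator_eq_zero G fun w huw hw => hj (nearSet_succ_of_adj huw hw)
  have hone := fun j => stepMean_indicator_le_one G (nearSet G S (j + 1)) u
  have h5 : 0 ≤ ρ ^ 5 := pow_nonneg hρ 5
  rw [stepMean_potential]
  by_cases h6 : u ∈ nearSet G S 6
  · specialize hcl h6
    specialize heq h6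
    have h1 : u ∉ nearSet G S 1 := by
      rintro (h | ⟨w, hw, -⟩)
      · exact hu h
      · exact hw
    -- The distance from `u` to `S` is `d + 1`.
    obtain ⟨d, hd, hd', hd''⟩ : ∃ d ∈ Finset.range 5,
        u ∉ nearSet G S (d + 1) ∧ u ∈ nearSet G S (d + 2) := by
      by_contra! h
      have h2 := h 0 (by simp) h1
      have h3 := h 1 (by simp) h2
      have h4 := h 2 (by simp) h3
      have h5 := h 3 (by simp) h4
      exact h 4 (by simp) h5 h6
    have hlow : ∀ j, j < d →
        stepMean G (fun w => if w ∈ nearSet G S (j + 1) then 1 else 0) u = 0 := fun j hj =>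
      hzero j fun h => hd' (nearSet_mono S (by omega) h)
    have hin : ∀ j, d < j → (if u ∈ nearSet G S (j + 1) then (1 : ℝ) else 0) = 1 := fun j hj =>
      if_pos (nearSet_mono S (by omega) hd'')
    have hout : ∀ j, j ≤ d → (if u ∈ nearSet G S (j + 1) then (1 : ℝ) else 0) = 0 := fun j hj =>
      if_neg fun h => hd' (nearSet_mono S (by omega) h)
    -- Only two balls change materially. The ball of radius `d` gains at most ρ^d · ρ/4 from closer
    -- neighbours; the ball of radius `d + 1` falls from ρ^(d+1) to at most a quarter of it. Larger
    -- balls cannot gain, smaller ones are out of reach.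
    have hterm : ∀ j ∈ Finset.range 5,
        ρ ^ j * stepMean G (fun w => if w ∈ nearSet G S (j + 1) then 1 else 0) u
          ≤ ρ ^ j * (if u ∈ nearSet G S (j + 1) then 1 else 0)
            + ((if j = d then ρ ^ (d + 1) / 4 else 0)
              - (if j = d + 1 then 3 / 4 * ρ ^ (d + 1) else 0)) := by
      intro j hj
      have hpow := pow_nonneg hρ j
      rcases lt_trichotomy j d with h | rfl | h
      · rw [hlow j h, hout j h.le, if_neg h.ne, if_neg (by omega)]
        simp
      · rw [hout j le_rfl, if_pos rfl, if_neg (by omega), pow_succ]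
        have := mul_le_mul_of_nonneg_left (hcl j hj hd') hpow
        linarith
      · rw [hin j h, if_neg h.ne']
        by_cases hjd : j = d + 1
        · subst hjd
          rw [if_pos rfl]
          have := mul_le_mul_of_nonneg_left
            (heq d (by have := Finset.mem_range.1 hj; simp only [Finset.mem_range]; omega) hd') hpow
          linarith
        · rw [if_neg hjd]
          have := mul_le_mul_of_nonneg_left (hone j) hpow
          linarith
    refine (Finset.sum_le_sum hterm).trans ?_
    rw [Finset.sum_add_distrib, Finset.sum_sub_distrib, Finset.sum_ite_eq' _ d,
      Finset.sum_ite_eq' _ (d + 1), if_pos hd]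
    unfold potential
    have hpow := pow_nonneg hρ (d + 1)
    refine add_le_add_right ?_ _
    split_ifs with h
    · linarith
    -- At the boundary there is no further ball to compensate; the gain ρ^5/4 is covered by the
    -- allowed error.
    · have : d = 4 := by simp only [Finset.mem_range] at h hd; omega
      subst this
      linarith
  · rw [Finset.sum_eq_zero]
    · exact add_nonneg (potential_nonneg S hρ u) h5
    · intro j hj
      have : j + 1 + 1 ≤ 6 := by have := Finset.mem_range.1 hj; omega
      rw [hzero j fun h => h6 (nearSet_mono S this h), mul_zero]

end Superharmonic

/-! ### Return and crossing probabilities on a typical graph -/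

section Deterministic

variable {n m : ℕ}

open Classical in
/-- The properties of the bipartite graph that the estimates for the walk rely on; `L` is the
logarithm of the number of vertices. -/
structure IsTypical (b : Links n m) (L ε Δ : ℝ) : Prop where
  sparse : LocallySparse b 40
  deg_le : ∀ v, (deg (interGraph b) v : ℝ) ≤ Δ * L
  attr_le : ∀ w, ((Finset.univ.filter fun v => b (v, w) = true).card : ℝ) ≤ ε / 32 * L
  deg_pos : ∀ v, 0 < deg (interGraph b) v
  separated : ∀ u v, u ≠ v → (sharedAttrs b u : ℝ) < ε * L → (sharedAttrs b v : ℝ) < ε * L →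
    10 < (interGraph b).edist u v

namespace IsTypical

variable {b : Links n m} {L ε Δ : ℝ}

lemma le_deg (h : IsTypical b L ε Δ) {v : Fin n} (hv : ¬ (sharedAttrs b v : ℝ) < ε * L) :
    ε * L / 2 ≤ deg (interGraph b) v := by
  have h1 : (sharedAttrs b v : ℝ) ≤ 2 * deg (interGraph b) v := by
    exact_mod_cast h.sparse.sharedAttrs_le (by norm_num) v
  linarith

/-- Two small vertices within 5 of `v` would be within 10 of each other, so at most one differs from
`v`. If there is none, `s = v` serves as a default. -/
lemma exists_small (h : IsTypical b L ε Δ) (v : Fin n) :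
    ∃ s, (s ≠ v → (sharedAttrs b s : ℝ) < ε * L ∧ (interGraph b).edist s v ≤ 5) ∧
      (interGraph b).edist s v ≤ 5 ∧
      ∀ u, (sharedAttrs b u : ℝ) < ε * L → (interGraph b).edist u v ≤ 5 → u = v ∨ u = s := by
  by_cases hs : ∃ s, s ≠ v ∧ (sharedAttrs b s : ℝ) < ε * L ∧ (interGraph b).edist s v ≤ 5
  · obtain ⟨s, hsv, hs, hd⟩ := hs
    refine ⟨s, fun _ => ⟨hs, hd⟩, hd, fun u hu hud => Or.inr ?_⟩
    by_contra hus
    refine (h.separated u s hus hu hs).not_ge ?_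
    refine (SimpleGraph.edist_triangle (v := v)).trans ?_
    rw [SimpleGraph.edist_comm (u := v)]
    exact (add_le_add hud hd).trans (by norm_num)
  · refine ⟨v, fun h => absurd rfl h, by simp, fun u hu hud => Or.inl ?_⟩
    by_contra huv
    exact hs ⟨u, huv, hu, hud⟩

/-- Once `v` and `s` belong to the target, no small vertex remains within distance 5 of it: one near
`v` would be `v` or `s`, and one near a small `s` would violate separation. -/
lemma not_small (h : IsTypical b L ε Δ) {v s u : Fin n}
    (hs : s ≠ v → (sharedAttrs b s : ℝ) < ε * L ∧ (interGraph b).edist s v ≤ 5)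
    (hs' : ∀ u, (sharedAttrs b u : ℝ) < ε * L → (interGraph b).edist u v ≤ 5 → u = v ∨ u = s)
    (hu : u ∉ ({v, s} : Set (Fin n))) (hun : u ∈ nearSet (interGraph b) {v, s} 6) :
    ¬ (sharedAttrs b u : ℝ) < ε * L := by
  intro hsm
  have huv : ¬ (interGraph b).edist u v ≤ 5 := fun hd => hu (by simpa using hs' u hsm hd)
  obtain ⟨z, hz, hd⟩ := exists_edist_le_of_mem_nearSet hun
  rcases hz with rfl | hz
  · exact huv (by exact_mod_cast hd)
  · have hzs : z = s := hz
    subst hzs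
    by_cases hzv : z = v
    · exact huv (by rw [hzv] at hd; exact_mod_cast hd)
    · refine (h.separated u z (fun h => hu (by simp [h])) hsm (hs hzv).1).not_ge (hd.trans ?_)
      norm_num

/-- Hitting `v` is controlled by the potential around `v` and the nearby small vertex. -/
lemma hitProb_le (h : IsTypical b L ε Δ) (hε : 0 < ε) (hL : 0 < L) {v s : Fin n}
    (hs : s ≠ v → (sharedAttrs b s : ℝ) < ε * L ∧ (interGraph b).edist s v ≤ 5)
    (hs' : ∀ u, (sharedAttrs b u : ℝ) < ε * L → (interGraph b).edist u v ≤ 5 → u = v ∨ u = s)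
    (t : ℕ) (u : Fin n) :
    hitProb (interGraph b) {v} t u
      ≤ potential (interGraph b) {v, s} (64 / (ε * L)) u + t * (64 / (ε * L)) ^ 5 := by
  classical
  have hεL : 0 < ε * L := mul_pos hε hL
  have hρ : 0 ≤ 64 / (ε * L) := by positivity
  refine (hitProb_mono _ (B := {v, s}) (by simp) t u).trans
    (hitProb_le_of_superharmonic _ (by positivity) (potential_nonneg _ hρ)
      (fun u hu => one_le_potential hρ hu) (fun u hu => ?_) t u)
  have hdeg : u ∈ nearSet (interGraph b) {v, s} 6 → ε * L / 2 ≤ deg (interGraph b) u :=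
    fun hun => h.le_deg (h.not_small hs hs' hu hun)
  have hpos : (0 : ℝ) < deg (interGraph b) u := by exact_mod_cast h.deg_pos u
  -- The constants match: 8 closer neighbours over degree at least εL/2 give 16/(εL) = ρ/4, and 4 ·
  -- (ε/32)L not farther ones give 1/4. Sparsity is needed here up to 31 nodes.
  refine stepMean_potential_le hρ hu (fun hun d hd hud => ?_) fun hun d hd hud => ?_
  · rw [stepMean_indicator, div_le_iff₀ hpos]
    have h1 : ((((interGraph b).neighborFinset u).filter
        (· ∈ nearSet (interGraph b) {v, s} (d + 1))).card : ℝ) ≤ 8 := by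
      exact_mod_cast h.sparse.card_closer_le (by have := Finset.mem_range.1 hd; omega) hud
    refine h1.trans ?_
    have h2 := mul_le_mul_of_nonneg_left (hdeg hun) (show 0 ≤ 64 / (ε * L) / 4 by positivity)
    refine le_trans (le_of_eq ?_) h2
    field_simp
    norm_num
  · rw [stepMean_indicator, div_le_iff₀ hpos]
    have hM : ∀ w, (Finset.univ.filter fun y => b (y, w) = true).card ≤ ⌊ε / 32 * L⌋₊ :=
      fun w => Nat.le_floor (h.attr_le w)
    have h1 : ((((interGraph b).neighborFinset u).filter
        (· ∈ nearSet (interGraph b) {v, s} (d + 2))).card : ℝ) ≤ 4 * ⌊ε / 32 * L⌋₊ := by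
      exact_mod_cast h.sparse.card_not_farther_le (by have := Finset.mem_range.1 hd; omega) hM hud
    have h2 : (⌊ε / 32 * L⌋₊ : ℝ) ≤ ε / 32 * L := Nat.floor_le (by positivity)
    have h3 := hdeg hun
    linarith

/-- After the first step the potential is at most 4ρ, except possibly at the small vertex `s`. The
constant is 266 = 4 · 64 + 10, the 10 coming from `s`. -/
lemma firstReturnProb_le (h : IsTypical b L ε Δ) (hε : 0 < ε) (hL : 0 < L) (hρ1 : 64 / (ε * L) ≤ 1)
    (t : ℕ) (v : Fin n) :
    firstReturnProb (interGraph b) (t + 2) v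
      ≤ 266 / (ε * L) + t * (64 / (ε * L)) ^ 5 := by
  classical
  have hεL : 0 < ε * L := mul_pos hε hL
  have hρ : 0 ≤ 64 / (ε * L) := by positivity
  obtain ⟨s, hs, hsd, hs'⟩ := h.exists_small v
  set ρ := 64 / (ε * L) with hρdef
  rw [firstReturnProb_eq _ h.deg_pos, stepMean_eq]
  have hpos : (0 : ℝ) < deg (interGraph b) v := by exact_mod_cast h.deg_pos v
  rw [div_le_iff₀ hpos]
  have hterm : ∀ u ∈ (interGraph b).neighborFinset v,
      hitProb (interGraph b) {v} t u ≤ (4 * ρ + t * ρ ^ 5) + if u = s then 5 else 0 := by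
    intro u hu
    rw [SimpleGraph.mem_neighborFinset] at hu
    refine (h.hitProb_le hε hL hs hs' t u).trans ?_
    split_ifs with hus
    · have := potential_le_five (G := interGraph b) {v, s} hρ hρ1 u
      linarith
    · have hnot : u ∉ ({v, s} : Set (Fin n)) := by simp [hu.1.symm, hus]
      have := potential_le_of_notMem (G := interGraph b) hρ hρ1 hnot
      linarith
  refine (Finset.sum_le_sum hterm).trans ?_
  rw [Finset.sum_add_distrib, Finset.sum_const, SimpleGraph.card_neighborFinset_eq_degree,
    nsmul_eq_mul, Finset.sum_ite_eq']
  change (deg (interGraph b) v : ℝ) * _ + _ ≤ _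
  -- If the small vertex `s` is adjacent to `v`, separation makes `v` not small, so stepping to `s`
  -- has probability at most 2/(εL).
  have h5 : (if s ∈ (interGraph b).neighborFinset v then (5 : ℝ) else 0)
      ≤ 10 / (ε * L) * deg (interGraph b) v := by
    split_ifs with hsn
    · rw [SimpleGraph.mem_neighborFinset] at hsn
      have hsv : s ≠ v := hsn.1.symm
      have hv : ¬ (sharedAttrs b v : ℝ) < ε * L := fun hv =>
        (h.separated s v hsv (hs hsv).1 hv).not_ge ((hs hsv).2.trans (by norm_num))
      have h2 := mul_le_mul_of_nonneg_left (h.le_deg hv) (show 0 ≤ 10 / (ε * L) by positivity)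
      refine le_trans (le_of_eq ?_) h2
      field_simp
      norm_num
    · positivity
  have h6 : (266 / (ε * L) + t * ρ ^ 5) * deg (interGraph b) v
      = deg (interGraph b) v * (4 * ρ + t * ρ ^ 5) + 10 / (ε * L) * deg (interGraph b) v := by
    rw [hρdef]; ring
  linarith

/-- A neighbour of `x` where the potential of the target near `y` is nonzero would give distance at
most 1 + 4 + 5 from `x` to `y`; so the potential vanishes there and only the accumulated error
remains. -/
lemma stepMean_hitProb_far_le (h : IsTypical b L ε Δ) (hε : 0 < ε) (hL : 0 < L) (t : ℕ)
    {x y : Fin n} (hxy : 20 ≤ (interGraph b).edist x y) :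
    stepMean (interGraph b) (hitProb (interGraph b) {y} t) x ≤ t * (64 / (ε * L)) ^ 5 := by
  classical
  have hεL : 0 < ε * L := mul_pos hε hL
  obtain ⟨s, hs, hsd, hs'⟩ := h.exists_small y
  have hpos : (0 : ℝ) < deg (interGraph b) x := by exact_mod_cast h.deg_pos x
  rw [stepMean_eq, div_le_iff₀ hpos, mul_comm]
  have hterm : ∀ u ∈ (interGraph b).neighborFinset x,
      hitProb (interGraph b) {y} t u ≤ t * (64 / (ε * L)) ^ 5 := by
    intro u hu
    rw [SimpleGraph.mem_neighborFinset] at hu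
    have hfar : u ∉ nearSet (interGraph b) {y, s} 5 := by
      intro hun
      obtain ⟨z, hz, hd⟩ := exists_edist_le_of_mem_nearSet hun
      have hzy : (interGraph b).edist z y ≤ 5 := by
        rcases hz with rfl | hz
        · simp
        · exact (show z = s from hz) ▸ hsd
      have h1 : (interGraph b).edist x u ≤ 1 := (SimpleGraph.edist_eq_one_iff_adj.2 hu).le
      have h2 : (interGraph b).edist x y ≤ 1 + (4 + 5) :=
        (SimpleGraph.edist_triangle (v := u)).trans (add_le_add h1
          ((SimpleGraph.edist_triangle (v := z)).trans (add_le_add (by exact_mod_cast hd) hzy)))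
      have h3 := hxy.trans h2
      norm_num at h3
    have h4 := h.hitProb_le hε hL hs hs' t u
    rwa [potential_eq_zero hfar, zero_add] at h4
  refine (Finset.sum_le_sum hterm).trans (le_of_eq ?_)
  rw [Finset.sum_const, SimpleGraph.card_neighborFinset_eq_degree, nsmul_eq_mul]
  rfl

/-- From any neighbour the walk goes straight back with probability at least 1/(ΔL). This takes two
steps, hence T ≥ 3. -/
lemma le_firstReturnProb (h : IsTypical b L ε Δ) (t : ℕ) (v : Fin n) :
    1 / (Δ * L) ≤ firstReturnProb (interGraph b) (t + 3) v := by
  classical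
  rw [firstReturnProb_eq _ h.deg_pos (t + 1), ← stepMean_const (interGraph b) (h.deg_pos v) (1 / _),
    stepMean_eq, stepMean_eq]
  refine div_le_div_of_nonneg_right (Finset.sum_le_sum fun u hu => ?_) (Nat.cast_nonneg _)
  rw [SimpleGraph.mem_neighborFinset] at hu
  rw [hitProb_succ_of_notMem _ (by simpa using hu.1.symm)]
  have hpos : (0 : ℝ) < deg (interGraph b) u := by exact_mod_cast h.deg_pos u
  calc 1 / (Δ * L) ≤ 1 / (deg (interGraph b) u : ℝ) := one_div_le_one_div_of_le hpos (h.deg_le u)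
    _ = stepProb (interGraph b) u v * hitProb (interGraph b) {v} t v := by
        rw [hitProb_of_mem _ (by simp), mul_one, stepProb, if_pos hu.symm]
    _ ≤ _ := Finset.single_le_sum (f := fun w => stepProb (interGraph b) u w *
        hitProb (interGraph b) {v} t w) (fun w _ => mul_nonneg (stepProb_nonneg _ _ _)
          (hitProb_nonneg _ _ _ _)) (Finset.mem_univ v)

end IsTypical

end Deterministic

/-! ### From return probabilities to generating functions and the degree identity -/

lemma norm_pow_le_exp {C₀ : ℝ} (hC₀ : 0 < C₀) {T : ℕ} (hT : 0 < T) {z : ℂ}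
    (hz : ‖z‖ ≤ 1 + (C₀ * T)⁻¹) {i : ℕ} (hi : i < T) : ‖z‖ ^ i ≤ Real.exp C₀⁻¹ := by
  have hT' : (0 : ℝ) < T := by exact_mod_cast hT
  have h1 : ‖z‖ ≤ Real.exp (C₀ * T)⁻¹ := hz.trans (by rw [add_comm]; exact Real.add_one_le_exp _)
  refine (pow_le_pow_left₀ (norm_nonneg z) h1 i).trans ?_
  rw [← Real.exp_nat_mul, Real.exp_le_exp]
  have h2 : (i : ℝ) ≤ T := by exact_mod_cast hi.le
  calc (i : ℝ) * (C₀ * T)⁻¹ ≤ T * (C₀ * T)⁻¹ := by gcongr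
    _ = C₀⁻¹ := by field_simp

/-- Generating function estimates from a bound on the first return probability. -/
lemma returnGF_estimates {V : Type} [Fintype V] (G : SimpleGraph V) (hG : ∀ u, 0 < deg G u)
    {C₀ : ℝ} (hC₀ : 0 < C₀) (t : ℕ) (v : V) {Q L : ℝ} (hL : 0 < L) (hQL : 2 * Q ≤ L)
    (hq : firstReturnProb G (t + 2) v ≤ Q / L) :
    (∀ z : ℂ, ‖z‖ ≤ 1 + (C₀ * (t + 2 : ℕ))⁻¹ →
      |‖returnGF G (t + 2) v z‖ - 1| ≤ Real.exp C₀⁻¹ * (2 * Q) / L) ∧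
    ‖returnGF G (t + 2) v 1 - (1 + (firstReturnProb G (t + 2) v : ℂ))‖ ≤ 2 * Q ^ 2 / L ^ 2 := by
  have hhalf : Q / L ≤ 1 / 2 := by rw [div_le_div_iff₀ hL two_pos]; linarith
  obtain ⟨h1, h2, h3⟩ := sum_returnProb_bounds G hG t v (hq.trans hhalf)
  have hq0 : 0 ≤ firstReturnProb G (t + 2) v := by
    rw [firstReturnProb_eq G hG]
    exact stepMean_nonneg G (hitProb_nonneg G _ t) v
  constructor
  · intro z hz
    refine (abs_norm_returnGF_sub_one_le G t v z
      fun i hi => norm_pow_le_exp hC₀ (by omega) hz hi).trans ?_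
    rw [mul_div_assoc]
    refine mul_le_mul_of_nonneg_left ?_ (Real.exp_pos _).le
    rw [mul_div_assoc]
    linarith
  · rw [returnGF_one, ← Complex.ofReal_one, ← Complex.ofReal_add, ← Complex.ofReal_sub,
      Complex.norm_real, Real.norm_of_nonneg (by linarith)]
    have h4 : firstReturnProb G (t + 2) v ^ 2 ≤ (Q / L) ^ 2 := pow_le_pow_left₀ hq0 hq 2
    rw [div_pow] at h4
    rw [mul_div_assoc]
    linarith

/-- Expand 1/(1 + q) = 1 − q + O(q²) in all three fractions; the linear terms cancel up to (a + b)η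
because `q` is nearly the weighted mean of `p` and `r`. -/
lemma abs_div_one_add_sub_le {a b q p r η B : ℝ} (ha : 0 ≤ a) (hb : 0 ≤ b) (hq : 0 ≤ q)
    (hp : 0 ≤ p) (hr : 0 ≤ r) (hqB : q ≤ B) (hpB : p ≤ B) (hrB : r ≤ B)
    (hlow : a * p + b * r ≤ (a + b) * q) (hupp : (a + b) * q ≤ a * p + b * r + (a + b) * η) :
    |(a + b) / (1 + q) - (a / (1 + p) + b / (1 + r))| ≤ (a + b) * (η + B ^ 2) := by
  have key : ∀ {a q : ℝ}, 0 ≤ a → 0 ≤ q → q ≤ B →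
      a - a * q ≤ a / (1 + q) ∧ a / (1 + q) ≤ a - a * q + a * B ^ 2 := by
    intro a q ha hq hqB
    have hsq : q ^ 2 ≤ B ^ 2 := pow_le_pow_left₀ hq hqB 2
    have h1 : 0 < 1 + q := by linarith
    constructor
    · rw [le_div_iff₀ h1]
      have : 0 ≤ a * q ^ 2 := by positivity
      nlinarith
    · rw [div_le_iff₀ h1]
      have h2 : 0 ≤ a * (B ^ 2 - q ^ 2) := mul_nonneg ha (by linarith)
      have h3 : 0 ≤ a * B ^ 2 * q := by positivity
      nlinarith
  obtain ⟨h1, h2⟩ := key (add_nonneg ha hb) hq hqB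
  obtain ⟨h3, h4⟩ := key ha hp hpB
  obtain ⟨h5, h6⟩ := key hb hr hrB
  rw [abs_le]
  constructor <;> nlinarith

namespace IsTypical

variable {n m : ℕ} {b : Links n m} {L ε Δ : ℝ}

/-- All the walk estimates hold on a typical graph. -/
theorem estimates (h : IsTypical b L ε Δ) (hε : 0 < ε) (hΔ : 0 < Δ) {Q C : ℝ}
    (hQ : Q = 266 / ε + 2 * (64 / ε) ^ 5) (hL : 1 ≤ L) (hQL : 2 * Q ≤ L)
    {T : ℕ} (hT : 3 ≤ T) (hTL : (T : ℝ) ≤ L ^ 3) {C₀ : ℝ} (hC₀ : 0 < C₀)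
    (hC : C = Δ + Real.exp C₀⁻¹ * (2 * Q) + 2 * Q ^ 2 + Q) :
    (∀ v : Fin n,
      (∀ z : ℂ, ‖z‖ ≤ 1 + (C₀ * T)⁻¹ → |‖returnGF (interGraph b) T v z‖ - 1| ≤ C / L) ∧
      C⁻¹ / L ≤ firstReturnProb (interGraph b) T v ∧
      firstReturnProb (interGraph b) T v ≤ C / L ∧
      ‖returnGF (interGraph b) T v 1 - (1 + (firstReturnProb (interGraph b) T v : ℂ))‖
        ≤ C / L ^ 2) ∧
    (∀ x y : Fin n, 20 ≤ (interGraph b).edist x y →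
      (∀ z : ℂ, ‖z‖ ≤ 1 + (C₀ * T)⁻¹ →
        |‖returnGF (mergedGraph (interGraph b) x y) T (mergedPoint x y) z‖ - 1| ≤ C / L) ∧
      C⁻¹ / L ≤ firstReturnProb (mergedGraph (interGraph b) x y) T (mergedPoint x y) ∧
      firstReturnProb (mergedGraph (interGraph b) x y) T (mergedPoint x y) ≤ C / L ∧
      ‖returnGF (mergedGraph (interGraph b) x y) T (mergedPoint x y) 1
          - (1 + (firstReturnProb (mergedGraph (interGraph b) x y) T (mergedPoint x y) : ℂ))‖
        ≤ C / L ^ 2 ∧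
      |((deg (interGraph b) x : ℝ) + deg (interGraph b) y)
          / (1 + firstReturnProb (mergedGraph (interGraph b) x y) T (mergedPoint x y))
        - ((deg (interGraph b) x : ℝ) / (1 + firstReturnProb (interGraph b) T x)
            + (deg (interGraph b) y : ℝ) / (1 + firstReturnProb (interGraph b) T y))|
        ≤ C * ((deg (interGraph b) x : ℝ) + deg (interGraph b) y) / L ^ 2) := by
  have hL0 : 0 < L := by linarith
  have hK : 0 < (64 / ε) ^ 5 := by positivity
  have hε1 : 0 < 266 / ε := by positivity
  have hQ0 : 0 < Q := by rw [hQ]; positivity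
  have hE : 0 < Real.exp C₀⁻¹ * (2 * Q) := by positivity
  have hC0 : 0 < C := by rw [hC]; positivity
  have hQ2 : 0 < Q ^ 2 := by positivity
  have hρ1 : 64 / (ε * L) ≤ 1 := by
    rw [← div_div, div_le_one hL0]
    have : 64 / ε ≤ 266 / ε := by gcongr; norm_num
    linarith
  obtain ⟨t, rfl⟩ : ∃ t, T = t + 2 := ⟨T - 2, by omega⟩
  obtain ⟨t', rfl⟩ : ∃ t', t = t' + 1 := ⟨t - 1, by omega⟩
  -- The accumulated superharmonicity error: T ≤ L³ against ρ^5 of order L⁻⁵.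
  have hpow : ((t' + 1 : ℕ) : ℝ) * (64 / (ε * L)) ^ 5 ≤ (64 / ε) ^ 5 / L ^ 2 := by
    have h1 : ((t' + 1 : ℕ) : ℝ) ≤ L ^ 3 := le_trans (by exact_mod_cast Nat.le_add_right _ 2) hTL
    calc ((t' + 1 : ℕ) : ℝ) * (64 / (ε * L)) ^ 5 ≤ L ^ 3 * (64 / (ε * L)) ^ 5 := by gcongr
      _ = (64 / ε) ^ 5 / L ^ 2 := by field_simp
  have hsq : (64 / ε) ^ 5 / L ^ 2 ≤ (64 / ε) ^ 5 / L :=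
    div_le_div_of_nonneg_left hK.le hL0 (by nlinarith)
  have hret : ∀ v, firstReturnProb (interGraph b) (t' + 1 + 2) v
      ≤ (266 / ε + (64 / ε) ^ 5) / L := fun v => by
    refine (h.firstReturnProb_le hε hL0 hρ1 (t' + 1) v).trans ?_
    rw [add_div, div_div]
    linarith
  have hretQ : ∀ v, firstReturnProb (interGraph b) (t' + 1 + 2) v ≤ Q / L := fun v =>
    (hret v).trans (by rw [hQ]; gcongr; linarith)
  have hlow : ∀ v, C⁻¹ / L ≤ firstReturnProb (interGraph b) (t' + 1 + 2) v := fun v => by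
    refine le_trans ?_ (h.le_firstReturnProb t' v)
    rw [← one_div, div_div]
    apply one_div_le_one_div_of_le (by positivity)
    gcongr
    rw [hC]; linarith
  have hnn : ∀ v, 0 ≤ firstReturnProb (interGraph b) (t' + 1 + 2) v := fun v => by
    refine le_trans ?_ (hlow v)
    positivity
  have hCQ : Q / L ≤ C / L := by gcongr; rw [hC]; linarith
  have hCE : Real.exp C₀⁻¹ * (2 * Q) / L ≤ C / L := by gcongr; rw [hC]; linarith
  have hCQ2 : 2 * Q ^ 2 / L ^ 2 ≤ C / L ^ 2 := by gcongr; rw [hC]; linarith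
  refine ⟨fun v => ?_, fun x y hxy => ?_⟩
  · obtain ⟨h1, h2⟩ := returnGF_estimates (interGraph b) h.deg_pos hC₀ (t' + 1) v hL0 hQL (hretQ v)
    exact ⟨fun z hz => (h1 z hz).trans hCE, hlow v, (hretQ v).trans hCQ, h2.trans hCQ2⟩
  · have hnadj : ¬ (interGraph b).Adj x y := by
      intro hadj
      rw [SimpleGraph.edist_eq_one_iff_adj.2 hadj] at hxy
      norm_num at hxy
    have hcommon : ∀ u, ¬ ((interGraph b).Adj u x ∧ (interGraph b).Adj u y) := by
      rintro u ⟨h1, h2⟩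
      have h3 := hxy.trans (SimpleGraph.edist_triangle (v := u))
      rw [SimpleGraph.edist_eq_one_iff_adj.2 h1.symm, SimpleGraph.edist_eq_one_iff_adj.2 h2] at h3
      norm_num at h3
    have hxy' : 20 ≤ (interGraph b).edist y x := by rwa [SimpleGraph.edist_comm]
    have hdx : (0 : ℝ) < deg (interGraph b) x := by exact_mod_cast h.deg_pos x
    have hdy : (0 : ℝ) < deg (interGraph b) y := by exact_mod_cast h.deg_pos y
    have hmul := deg_mul_firstReturnProb_mergedGraph (interGraph b) hnadj hcommon h.deg_pos (t' + 1)
    -- Hitting {u, v} from `u` is a return to `u` or a crossing to `v`, and a crossing costs O(L⁻²).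
    have hbd : ∀ u v : Fin n, 20 ≤ (interGraph b).edist u v →
        firstReturnProb (interGraph b) (t' + 1 + 2) u
          ≤ stepMean (interGraph b) (hitProb (interGraph b) {u, v} (t' + 1)) u ∧
        stepMean (interGraph b) (hitProb (interGraph b) {u, v} (t' + 1)) u
          ≤ firstReturnProb (interGraph b) (t' + 1 + 2) u + (64 / ε) ^ 5 / L ^ 2 := by
      intro u v huv
      rw [firstReturnProb_eq _ h.deg_pos]
      refine ⟨stepMean_mono _ (hitProb_mono _ (by simp) _) u, ?_⟩
      refine (stepMean_mono _ (hitProb_union_le _ {u} {v} (t' + 1)) u).trans ?_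
      rw [stepMean_add]
      exact add_le_add_right ((h.stepMean_hitProb_far_le hε hL0 (t' + 1) huv).trans hpow) _
    obtain ⟨hx1, hx2⟩ := hbd x y hxy
    obtain ⟨hy1, hy2⟩ := hbd y x hxy'
    rw [Set.pair_comm] at hy1 hy2
    have hlow' := hlow x
    have hlow'' := hlow y
    have hretx := hret x
    have hrety := hret y
    have hretQx := hretQ x
    have hretQy := hretQ y
    have hnnx := hnn x
    have hnny := hnn y
    set q := firstReturnProb (mergedGraph (interGraph b) x y) (t' + 1 + 2) (mergedPoint x y) with hq
    set px := firstReturnProb (interGraph b) (t' + 1 + 2) x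
    set py := firstReturnProb (interGraph b) (t' + 1 + 2) y
    set dx := (deg (interGraph b) x : ℝ)
    set dy := (deg (interGraph b) y : ℝ)
    have hd : 0 < dx + dy := add_pos hdx hdy
    have hlowq : dx * px + dy * py ≤ (dx + dy) * q := by
      rw [hmul]
      exact add_le_add (mul_le_mul_of_nonneg_left hx1 hdx.le) (mul_le_mul_of_nonneg_left hy1 hdy.le)
    have huppq : (dx + dy) * q ≤ dx * px + dy * py + (dx + dy) * ((64 / ε) ^ 5 / L ^ 2) := by
      rw [hmul]
      have h1 := mul_le_mul_of_nonneg_left hx2 hdx.le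
      have h2 := mul_le_mul_of_nonneg_left hy2 hdy.le
      linarith
    have hqlow : C⁻¹ / L ≤ q := by
      have h1 := mul_le_mul_of_nonneg_left hlow' hdx.le
      have h2 := mul_le_mul_of_nonneg_left hlow'' hdy.le
      refine le_of_mul_le_mul_left ?_ hd
      linarith
    have hqQ : q ≤ Q / L := by
      have h1 := mul_le_mul_of_nonneg_left hretx hdx.le
      have h2 := mul_le_mul_of_nonneg_left hrety hdy.le
      have h3 := mul_le_mul_of_nonneg_left hsq hd.le
      -- `Q` contains (64/ε)^5 twice: once for the error in the return bound, once for crossing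
      -- between `x` and `y`.
      have h4 : Q / L = (266 / ε + (64 / ε) ^ 5) / L + (64 / ε) ^ 5 / L := by rw [hQ]; ring
      refine le_of_mul_le_mul_left ?_ hd
      rw [h4]
      linarith
    have hq0 : 0 ≤ q := le_trans (by positivity) hqlow
    obtain ⟨h1, h2⟩ := returnGF_estimates (mergedGraph (interGraph b) x y)
      (deg_mergedGraph_pos _ hnadj hcommon h.deg_pos) hC₀ (t' + 1) (mergedPoint x y) hL0 hQL hqQ
    refine ⟨fun z hz => (h1 z hz).trans hCE, hqlow, hqQ.trans hCQ, h2.trans hCQ2, ?_⟩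
    refine (abs_div_one_add_sub_le hdx.le hdy.le hq0 hnnx hnny hqQ hretQx hretQy hlowq huppq).trans ?_
    have h5 : (dx + dy) * ((64 / ε) ^ 5 / L ^ 2 + (Q / L) ^ 2)
        = ((64 / ε) ^ 5 + Q ^ 2) * (dx + dy) / L ^ 2 := by rw [div_pow]; ring
    rw [h5]
    gcongr
    rw [hC]
    linarith

end IsTypical

/-! ### Product expectations and Markov's inequality for independent links -/

section Expectation

variable {n m : ℕ} (p : ℝ)

/-- The probability of the value `β` of a single link. -/
def linkWeight (β : Bool) : ℝ := if β then p else 1 - p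

/-- The expectation of a function of a family of independent links. -/
noncomputable def linkMean {ι : Type} [Fintype ι] [DecidableEq ι] (f : (ι → Bool) → ℝ) : ℝ :=
  ∑ c : ι → Bool, (∏ v, linkWeight p (c v)) * f c

variable {p}

lemma linkWeight_nonneg (hp0 : 0 ≤ p) (hp1 : p ≤ 1) (β : Bool) : 0 ≤ linkWeight p β := by
  unfold linkWeight; split_ifs <;> linarith

lemma linkMean_mono {ι : Type} [Fintype ι] [DecidableEq ι] (hp0 : 0 ≤ p) (hp1 : p ≤ 1) {f g : (ι → Bool) → ℝ}
    (h : ∀ c, f c ≤ g c) : linkMean p f ≤ linkMean p g :=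
  Finset.sum_le_sum fun c _ => mul_le_mul_of_nonneg_left (h c)
    (Finset.prod_nonneg fun v _ => linkWeight_nonneg hp0 hp1 (c v))

lemma linkMean_add {ι : Type} [Fintype ι] [DecidableEq ι] (f g : (ι → Bool) → ℝ) :
    linkMean p (fun c => f c + g c) = linkMean p f + linkMean p g := by
  simp only [linkMean, mul_add, Finset.sum_add_distrib]

lemma linkMean_const_mul {ι : Type} [Fintype ι] [DecidableEq ι] (a : ℝ) (f : (ι → Bool) → ℝ) :
    linkMean p (fun c => a * f c) = a * linkMean p f := by
  simp only [linkMean, Finset.mul_sum]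
  exact Finset.sum_congr rfl fun c _ => by ring

lemma linkMean_prod {ι : Type} [Fintype ι] [DecidableEq ι] (g : ι → Bool → ℝ) :
    linkMean p (fun c => ∏ v, g v (c v)) = ∏ v, (p * g v true + (1 - p) * g v false) := by
  have h : ∀ v, p * g v true + (1 - p) * g v false = ∑ β : Bool, linkWeight p β * g v β := by
    intro v; simp [linkWeight]
  simp only [h]
  rw [Finset.prod_univ_sum, Fintype.piFinset_univ]
  unfold linkMean
  simp only [Finset.prod_mul_distrib]

lemma linkMean_one {ι : Type} [Fintype ι] [DecidableEq ι] : linkMean p (fun _ : ι → Bool => 1) = 1 := by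
  simpa using linkMean_prod (p := p) (fun (_ : ι) (_ : Bool) => (1 : ℝ))

lemma linkMean_prod_ite (A : Finset (Fin n)) (α β : Bool → ℝ) :
    linkMean p (fun c : Fin n → Bool => ∏ v, if v ∈ A then α (c v) else β (c v))
      = (p * α true + (1 - p) * α false) ^ A.card
        * (p * β true + (1 - p) * β false) ^ (n - A.card) := by
  have h := linkMean_prod (p := p) fun (v : Fin n) x => if v ∈ A then α x else β x
  rw [h]
  have h2 : ∀ v, (p * (if v ∈ A then α true else β true)
      + (1 - p) * (if v ∈ A then α false else β false))
      = if v ∈ A then p * α true + (1 - p) * α false else p * β true + (1 - p) * β false := by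
    intro v; split_ifs <;> rfl
  simp only [h2]
  rw [Finset.prod_ite, Finset.prod_const, Finset.prod_const]
  congr 2
  · simp
  · have : (Finset.univ.filter fun v => v ∉ A) = Aᶜ := by ext; simp
    rw [this, Finset.card_compl, Fintype.card_fin]

/-- Different attributes behave independently. -/
lemma linkMean_columns (G : Fin m → (Fin n → Bool) → ℝ) :
    linkMean p (fun b : Links n m => ∏ w, G w fun v => b (v, w)) = ∏ w, linkMean p (G w) := by
  unfold linkMean
  rw [Finset.prod_univ_sum, Fintype.piFinset_univ]
  refine Fintype.sum_equiv (⟨fun b w v => b (v, w), fun c e => c e.2 e.1, fun _ => rfl, fun _ => rfl⟩ :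
    (Fin n × Fin m → Bool) ≃ (Fin m → Fin n → Bool)) _ _ fun b => ?_
  rw [Finset.prod_mul_distrib, Fintype.prod_prod_type_right]
  rfl

lemma linkLaw_singleton (p : unitInterval) (b : Links n m) :
    linkLaw n m p {b} = ENNReal.ofReal (∏ e, linkWeight p (b e)) := by
  unfold linkLaw
  rw [Measure.pi_singleton, ENNReal.ofReal_prod_of_nonneg
    fun e _ => linkWeight_nonneg p.2.1 p.2.2 (b e)]
  refine Finset.prod_congr rfl fun e _ => ?_
  cases h : b e
  · rw [ProbabilityTheory.bernoulliMeasure_apply_of_notMem_of_mem _ (measurableSet_singleton _)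
      (by simp) (by simp), ← ENNReal.ofReal_coe_nnreal]
    simp [linkWeight]
  · rw [ProbabilityTheory.bernoulliMeasure_apply_of_mem_of_notMem _ (measurableSet_singleton _)
      (by simp) (by simp), ← ENNReal.ofReal_coe_nnreal]
    simp [linkWeight]

/-- Markov's inequality for the law of the bipartite graph. -/
lemma linkLaw_le (p : unitInterval) {E : Set (Links n m)} {f : Links n m → ℝ} {B : ℝ}
    (h0 : ∀ b, 0 ≤ f b) (h1 : ∀ b ∈ E, 1 ≤ f b) (hB : linkMean p f ≤ B) :
    linkLaw n m p E ≤ ENNReal.ofReal B := by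
  classical
  calc linkLaw n m p E ≤ ∫⁻ b, ENNReal.ofReal (f b) ∂(linkLaw n m p) := by
        rw [← lintegral_indicator_one (MeasurableSet.of_discrete)]
        refine lintegral_mono fun b => ?_
        by_cases hb : b ∈ E
        · rw [Set.indicator_of_mem hb]
          simpa using h1 b hb
        · rw [Set.indicator_of_notMem hb]
          exact zero_le
    _ = ENNReal.ofReal (linkMean p f) := by
        rw [lintegral_fintype, linkMean, ENNReal.ofReal_sum_of_nonneg]
        · refine Finset.sum_congr rfl fun b _ => ?_
          rw [linkLaw_singleton, mul_comm, ENNReal.ofReal_mul]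
          exact Finset.prod_nonneg fun v _ => linkWeight_nonneg p.2.1 p.2.2 (b v)
        · exact fun b _ => mul_nonneg
            (Finset.prod_nonneg fun v _ => linkWeight_nonneg p.2.1 p.2.2 (b v)) (h0 b)
    _ ≤ ENNReal.ofReal B := ENNReal.ofReal_le_ofReal hB

end Expectation

/-! ### Tail bounds for a single vertex or attribute -/

section Tails

variable {n m : ℕ} (p : unitInterval)

lemma prod_ite_singleton (v : Fin n) (c : Fin n → Bool) (α β : Bool → ℝ) :
    (∏ u, if u ∈ ({v} : Finset (Fin n)) then α (c u) else β (c u))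
      = α (c v) * ∏ u ∈ Finset.univ.erase v, β (c u) := by
  rw [← Finset.mul_prod_erase Finset.univ _ (Finset.mem_univ v), if_pos (Finset.mem_singleton_self v)]
  refine congrArg _ (Finset.prod_congr rfl fun u hu => ?_)
  rw [if_neg (by simpa using Finset.ne_of_mem_erase hu)]

lemma prod_exp_ite (s : Finset (Fin n)) (c : Fin n → Bool) (θ : ℝ) :
    ∏ u ∈ s, (if c u = true then Real.exp θ else 1)
      = Real.exp (θ * (s.filter fun u => c u = true).card) := by
  rw [Finset.prod_ite, Finset.prod_const_one, mul_one, Finset.prod_const, ← Real.exp_nat_mul,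
    mul_comm]

lemma deg_le_sum (b : Links n m) (v : Fin n) :
    deg (interGraph b) v ≤ ∑ w, if b (v, w) = true then
      ((Finset.univ.erase v).filter fun u => b (u, w) = true).card else 0 := by
  classical
  have hsub : (interGraph b).neighborFinset v ⊆ (Finset.univ.filter fun w => b (v, w) = true).biUnion
      fun w => (Finset.univ.erase v).filter fun u => b (u, w) = true := by
    intro u hu
    rw [SimpleGraph.mem_neighborFinset] at hu
    obtain ⟨hne, w, hv, hu⟩ := hu
    simp only [Finset.mem_biUnion, Finset.mem_filter, Finset.mem_univ, true_and, Finset.mem_erase,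
      and_true]
    exact ⟨w, hv, hne.symm, hu⟩
  have h := (Finset.card_le_card hsub).trans Finset.card_biUnion_le
  rw [SimpleGraph.card_neighborFinset_eq_degree, Finset.sum_filter] at h
  unfold deg
  exact h

/-- Chernoff bound with parameter 1 for the sum, over the attributes of `v`, of the numbers of other
members. This sum dominates the degree and its exponential is a product over attributes. -/
lemma linkLaw_deg_ge_le (v : Fin n) (t : ℝ) :
    linkLaw n m p {b | t ≤ deg (interGraph b) v}
      ≤ ENNReal.ofReal (Real.exp (-t) *
        (p * (p * Real.exp 1 + (1 - p)) ^ (n - 1) + (1 - p)) ^ m) := by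
  -- The exponential for one attribute, split according to whether `v` has it, so that each summand
  -- is a product over vertices.
  let G : (Fin n → Bool) → ℝ := fun c =>
    (∏ u, if u ∈ ({v} : Finset (Fin n)) then (if c u = true then 1 else 0)
      else (if c u = true then Real.exp 1 else 1))
    + ∏ u, if u ∈ ({v} : Finset (Fin n)) then (if c u = true then 0 else 1) else 1
  have hG : ∀ c, G c = if c v = true then
      Real.exp (((Finset.univ.erase v).filter fun u => c u = true).card) else 1 := by
    intro c
    have h1 := prod_ite_singleton v c (fun x => if x = true then 1 else 0)
      (fun x => if x = true then Real.exp 1 else 1)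
    have h2 := prod_ite_singleton v c (fun x => if x = true then 0 else 1) (fun _ => 1)
    simp only [G]
    rw [h1, h2, prod_exp_ite]
    split_ifs <;> simp
  have hmean : linkMean (p : ℝ) G = p * (p * Real.exp 1 + (1 - p)) ^ (n - 1) + (1 - p) := by
    have h1 := linkMean_prod_ite (p := (p : ℝ)) ({v} : Finset (Fin n))
      (fun x => if x = true then 1 else 0) (fun x => if x = true then Real.exp 1 else 1)
    have h2 := linkMean_prod_ite (p := (p : ℝ)) ({v} : Finset (Fin n))
      (fun x => if x = true then 0 else 1) (fun _ => 1)
    simp only [G]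
    rw [linkMean_add, h1, h2]
    simp
  refine linkLaw_le p (f := fun b => Real.exp (-t) * ∏ w, G fun v => b (v, w)) (fun b => ?_)
    (fun b hb => ?_) (le_of_eq ?_)
  · refine mul_nonneg (Real.exp_pos _).le (Finset.prod_nonneg fun w _ => ?_)
    rw [hG]; split_ifs <;> positivity
  · have h1 : ∏ w, G (fun v => b (v, w)) = Real.exp (∑ w, ((if b (v, w) = true then
        ((Finset.univ.erase v).filter fun u => b (u, w) = true).card else 0 : ℕ) : ℝ)) := by
      rw [Real.exp_sum]
      refine Finset.prod_congr rfl fun w _ => ?_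
      rw [hG]
      split_ifs <;> simp
    rw [h1, ← Real.exp_add, ← Nat.cast_sum]
    refine Real.one_le_exp ?_
    have h2 : (deg (interGraph b) v : ℝ) ≤ _ := Nat.cast_le.2 (deg_le_sum b v)
    have h3 : t ≤ deg (interGraph b) v := hb
    linarith
  · rw [linkMean_const_mul, linkMean_columns (fun _ => G), Finset.prod_const, hmean]
    simp

lemma linkLaw_attr_ge_le (w : Fin m) (θ t : ℝ) :
    linkLaw n m p {b | θ * t ≤ θ * (Finset.univ.filter fun v => b (v, w) = true).card}
      ≤ ENNReal.ofReal (Real.exp (-(θ * t)) * (p * Real.exp θ + (1 - p)) ^ n) := by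
  refine linkLaw_le p (f := fun b => Real.exp (-(θ * t)) * ∏ w', if w' = w then
      ∏ v, (if b (v, w') = true then Real.exp θ else 1) else 1) (fun b => ?_)
    (fun b hb => ?_) (le_of_eq ?_)
  · refine mul_nonneg (Real.exp_pos _).le (Finset.prod_nonneg fun w _ => ?_)
    split_ifs
    · exact Finset.prod_nonneg fun v _ => by split_ifs <;> positivity
    · exact zero_le_one
  · rw [Finset.prod_ite_eq' Finset.univ w, if_pos (Finset.mem_univ w),
      prod_exp_ite Finset.univ fun v => b (v, w), ← Real.exp_add]
    refine Real.one_le_exp ?_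
    have h3 : θ * t ≤ _ := hb
    linarith
  · rw [linkMean_const_mul]
    have h := linkMean_columns (p := (p : ℝ)) (n := n) (m := m) fun w' c => if w' = w then
      ∏ v, (if c v = true then Real.exp θ else 1) else 1
    rw [h]
    have h2 : ∀ w', linkMean (p : ℝ) (fun c : Fin n → Bool => if w' = w then
        ∏ v, (if c v = true then Real.exp θ else 1) else 1)
        = if w' = w then (p * Real.exp θ + (1 - p)) ^ n else 1 := by
      intro w'
      split_ifs
      · rw [linkMean_prod fun _ x => if x = true then Real.exp θ else 1]
        simp
      · exact linkMean_one
    simp only [h2]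
    rw [Finset.prod_ite_eq' Finset.univ w, if_pos (Finset.mem_univ w)]

/-- `v` is isolated only if every attribute either misses `v` or contains `v` alone; these
constraints are independent across attributes. -/
lemma linkLaw_deg_eq_zero_le (v : Fin n) :
    linkLaw n m p {b | deg (interGraph b) v = 0}
      ≤ ENNReal.ofReal ((p * (1 - p) ^ (n - 1) + (1 - p)) ^ m) := by
  classical
  let G : (Fin n → Bool) → ℝ := fun c =>
    (∏ u, if u ∈ ({v} : Finset (Fin n)) then (if c u = true then 1 else 0)
      else (if c u = true then 0 else 1))
    + ∏ u, if u ∈ ({v} : Finset (Fin n)) then (if c u = true then 0 else 1) else 1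
  have hG : ∀ c, G c = (if c v = true then 1 else 0) *
      (∏ u ∈ Finset.univ.erase v, if c u = true then 0 else 1) + if c v = true then 0 else 1 := by
    intro c
    have h1 := prod_ite_singleton v c (fun x => if x = true then 1 else 0)
      (fun x => if x = true then 0 else 1)
    have h2 := prod_ite_singleton v c (fun x => if x = true then 0 else 1) (fun _ => 1)
    simp only [G]
    rw [h1, h2]
    simp
  have hmean : linkMean (p : ℝ) G = p * (1 - p) ^ (n - 1) + (1 - p) := by
    have h1 := linkMean_prod_ite (p := (p : ℝ)) ({v} : Finset (Fin n))
      (fun x => if x = true then 1 else 0) (fun x => if x = true then 0 else 1)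
    have h2 := linkMean_prod_ite (p := (p : ℝ)) ({v} : Finset (Fin n))
      (fun x => if x = true then 0 else 1) (fun _ => 1)
    simp only [G]
    rw [linkMean_add, h1, h2]
    simp
  have hG0 : ∀ c, 0 ≤ G c := fun c => by
    rw [hG]
    refine add_nonneg (mul_nonneg ?_ (Finset.prod_nonneg fun u _ => ?_)) ?_ <;> split_ifs <;> norm_num
  refine linkLaw_le p (f := fun b => ∏ w, G fun v => b (v, w))
    (fun b => Finset.prod_nonneg fun w _ => hG0 _) (fun b hb => ?_) (le_of_eq ?_)
  · rw [Finset.prod_eq_one]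
    intro w _
    rw [hG]
    by_cases hv : b (v, w) = true
    · have : ∀ u ∈ Finset.univ.erase v, (if b (u, w) = true then (0 : ℝ) else 1) = 1 := by
        intro u hu
        refine if_neg fun huw => ?_
        have hb' : (interGraph b).degree v = 0 := by
          have : deg (interGraph b) v = 0 := hb
          unfold deg at this
          convert this
        rw [← SimpleGraph.card_neighborFinset_eq_degree, Finset.card_eq_zero] at hb'
        have hmem : u ∈ (interGraph b).neighborFinset v := by
          rw [SimpleGraph.mem_neighborFinset]
          exact ⟨(Finset.ne_of_mem_erase hu).symm, w, hv, huw⟩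
        rw [hb'] at hmem
        simp at hmem
      rw [Finset.prod_congr rfl this]
      simp [hv]
    · simp [hv]
  · rw [linkMean_columns (fun _ => G), Finset.prod_const, hmean]
    simp

end Tails

/-! ### Prescribed links together with few shared attributes -/

section Patterns

variable {n m : ℕ}

/-- The expectation of the indicator that the links in `F` are present times a product over the
attributes outside `W`. -/
lemma linkMean_pattern (p : ℝ) {F : Finset (Fin n × Fin m)} {W : Finset (Fin m)}
    (hF : ∀ e ∈ F, e.2 ∈ W) (g : (Fin n → Bool) → ℝ) :
    linkMean p (fun b : Links n m => ∏ w, if w ∈ W then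
        ∏ x, (if (x, w) ∈ F then (if b (x, w) = true then 1 else 0) else 1)
        else g fun x => b (x, w))
      = p ^ F.card * linkMean p g ^ (m - W.card) := by
  have h := linkMean_columns (p := p) (n := n) (m := m) fun w c => if w ∈ W then
      ∏ x, (if (x, w) ∈ F then (if c x = true then 1 else 0) else 1) else g c
  rw [h]
  have h2 : ∀ w, linkMean p (fun c : Fin n → Bool => if w ∈ W then
      ∏ x, (if (x, w) ∈ F then (if c x = true then 1 else 0) else 1) else g c)
      = if w ∈ W then p ^ (F.filter fun e => e.2 = w).card else linkMean p g := by
    intro w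
    split_ifs with hw
    · have h3 := linkMean_prod (p := p) fun (x : Fin n) β =>
        if (x, w) ∈ F then (if β = true then (1 : ℝ) else 0) else 1
      rw [h3]
      have h4 : ∀ x : Fin n, (p * (if (x, w) ∈ F then (if (true : Bool) = true then (1 : ℝ) else 0) else 1)
          + (1 - p) * (if (x, w) ∈ F then (if (false : Bool) = true then (1 : ℝ) else 0) else 1))
          = if (x, w) ∈ F then p else 1 := by
        intro x; split_ifs <;> simp_all
      rw [Finset.prod_congr rfl fun x _ => h4 x, Finset.prod_ite, Finset.prod_const_one, mul_one, Finset.prod_const]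
      congr 1
      refine Finset.card_bij (fun x _ => (x, w)) ?_ ?_ ?_
      · intro x hx
        simpa using hx
      · intro x _ y _ hxy
        exact congrArg Prod.fst hxy
      · rintro ⟨x, w'⟩ he
        obtain ⟨he, rfl⟩ := Finset.mem_filter.1 he
        exact ⟨x, by simpa using he, rfl⟩
    · rfl
  simp only [h2]
  rw [Finset.prod_ite, Finset.prod_const, Finset.filter_mem_eq_inter, Finset.univ_inter,
    Finset.prod_pow_eq_pow_sum, Finset.card_eq_sum_card_fiberwise (f := Prod.snd) (t := W) hF]
  congr 2
  have : (Finset.univ.filter fun w => w ∉ W) = Wᶜ := by ext; simp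
  rw [this, Finset.card_compl, Fintype.card_fin]

lemma linkLaw_pattern_le (p : unitInterval) (F : Finset (Fin n × Fin m)) :
    linkLaw n m p {b | ∀ e ∈ F, b e = true} ≤ ENNReal.ofReal ((p : ℝ) ^ F.card) := by
  refine linkLaw_le p (fun b => ?_) (fun b hb => ?_)
    (le_of_eq ((linkMean_pattern (p : ℝ) (F := F) (W := Finset.univ) (fun e _ => Finset.mem_univ _)
      (fun _ => 1)).trans (by simp)))
  · refine Finset.prod_nonneg fun w _ => ?_
    rw [if_pos (Finset.mem_univ w)]
    exact Finset.prod_nonneg fun x _ => by split_ifs <;> norm_num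
  · rw [Finset.prod_eq_one]
    intro w _
    rw [if_pos (Finset.mem_univ w), Finset.prod_eq_one]
    intro x _
    split_ifs with h1 h2
    · rfl
    · exact absurd (hb _ h1) h2
    · rfl

open Classical in
/-- The indicator that a column contains `u` or `v`, and some other vertex. -/
noncomputable def touches (u v : Fin n) (c : Fin n → Bool) : ℝ :=
  if (c u = true ∨ c v = true) ∧ ∃ z, z ≠ u ∧ z ≠ v ∧ c z = true then 1 else 0

/-- Inclusion–exclusion (1 − A)(1 − B), with A and B the indicators that the column misses {u, v}
and misses its complement. Each term is a product over vertices, so its expectation factorises. -/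
lemma touches_eq (u v : Fin n) (c : Fin n → Bool) :
    touches u v c = 1 + (-1 * (∏ x, if x ∈ ({u, v} : Finset (Fin n)) then
        (if c x = true then 0 else 1) else 1)
      + (-1 * (∏ x, if x ∈ ({u, v} : Finset (Fin n)) then 1 else (if c x = true then 0 else 1))
      + ∏ x, if x ∈ ({u, v} : Finset (Fin n)) then (if c x = true then 0 else 1)
          else (if c x = true then 0 else 1))) := by
  have h1 : (∏ x, if x ∈ ({u, v} : Finset (Fin n)) then (if c x = true then (0 : ℝ) else 1) else 1)
      = if c u = true ∨ c v = true then 0 else 1 := by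
    split_ifs with h
    · rcases h with h | h
      · exact Finset.prod_eq_zero (Finset.mem_univ u) (by simp [h])
      · exact Finset.prod_eq_zero (Finset.mem_univ v) (by simp [h])
    · refine Finset.prod_eq_one fun x _ => ?_
      split_ifs with hx hc
      · simp only [Finset.mem_insert, Finset.mem_singleton] at hx
        rcases hx with rfl | rfl
        · exact absurd (Or.inl hc) h
        · exact absurd (Or.inr hc) h
      · rfl
      · rfl
  have h2 : (∏ x, if x ∈ ({u, v} : Finset (Fin n)) then 1 else (if c x = true then (0 : ℝ) else 1))
      = if ∃ z, z ≠ u ∧ z ≠ v ∧ c z = true then 0 else 1 := by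
    split_ifs with h
    · obtain ⟨z, hzu, hzv, hz⟩ := h
      exact Finset.prod_eq_zero (Finset.mem_univ z) (by simp [hz, hzu, hzv])
    · refine Finset.prod_eq_one fun x _ => ?_
      split_ifs with hx hc
      · rfl
      · simp only [Finset.mem_insert, Finset.mem_singleton, not_or] at hx
        exact absurd ⟨x, hx.1, hx.2, hc⟩ h
      · rfl
  have h3 : (∏ x, if x ∈ ({u, v} : Finset (Fin n)) then (if c x = true then (0 : ℝ) else 1)
      else (if c x = true then 0 else 1))
      = (∏ x, if x ∈ ({u, v} : Finset (Fin n)) then (if c x = true then (0 : ℝ) else 1) else 1)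
        * ∏ x, if x ∈ ({u, v} : Finset (Fin n)) then 1 else (if c x = true then (0 : ℝ) else 1) := by
    rw [← Finset.prod_mul_distrib]
    refine Finset.prod_congr rfl fun x _ => ?_
    split_ifs <;> simp
  rw [h3, h1, h2, touches]
  by_cases ha : c u = true ∨ c v = true <;> by_cases hb : ∃ z, z ≠ u ∧ z ≠ v ∧ c z = true <;>
    simp only [ha, hb, and_self, and_false, false_and, if_true, if_false] <;> norm_num

lemma linkMean_touches (p : ℝ) {u v : Fin n} (huv : u ≠ v) :
    linkMean p (touches u v) = 1 - (1 - p) ^ 2 - (1 - p) ^ (n - 2) + (1 - p) ^ n := by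
  have hcard : ({u, v} : Finset (Fin n)).card = 2 := Finset.card_pair huv
  have hn : 2 ≤ n := by
    have := Finset.card_le_univ ({u, v} : Finset (Fin n))
    rwa [hcard, Fintype.card_fin] at this
  have e : touches u v = _ := funext (touches_eq u v)
  rw [e, linkMean_add, linkMean_one, linkMean_add, linkMean_const_mul, linkMean_add,
    linkMean_const_mul]
  have h1 := linkMean_prod_ite (p := p) ({u, v} : Finset (Fin n))
    (fun x => if x = true then 0 else 1) (fun _ => 1)
  have h2 := linkMean_prod_ite (p := p) ({u, v} : Finset (Fin n))
    (fun _ => 1) (fun x => if x = true then 0 else 1)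
  have h3 := linkMean_prod_ite (p := p) ({u, v} : Finset (Fin n))
    (fun x => if x = true then 0 else 1) (fun x => if x = true then 0 else 1)
  rw [h1, h2, h3, hcard]
  simp only [Bool.false_eq_true, if_false, if_true, mul_zero, zero_add, mul_one, add_sub_cancel,
    one_pow, one_mul]
  rw [← pow_add, Nat.add_sub_cancel' hn]
  ring

/-- For a 0–1 variable X, exp(−θX) = 1 − (1 − e^{−θ})X; then use 1 + x ≤ e^x. -/
lemma linkMean_exp_touches_le (p : ℝ) {u v : Fin n} (huv : u ≠ v) (θ : ℝ) :
    linkMean p (fun c => Real.exp (-θ * touches u v c))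
      ≤ Real.exp (-(1 - Real.exp (-θ)) *
          (1 - (1 - p) ^ 2 - (1 - p) ^ (n - 2) + (1 - p) ^ n)) := by
  have e : (fun c => Real.exp (-θ * touches u v c))
      = fun c => 1 + (-(1 - Real.exp (-θ))) * touches u v c := by
    ext c
    unfold touches
    split_ifs <;> simp
  rw [e, linkMean_add, linkMean_one, linkMean_const_mul, linkMean_touches p huv, add_comm]
  exact Real.add_one_le_exp _

/-- An attribute joining {u, v} to a third vertex is shared by `u` or by `v`. Counting the pair
jointly gives about twice the single-vertex mean, which is what later beats the factor 1/p. -/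
lemma sum_touches_le (b : Links n m) (W : Finset (Fin m)) (u v : Fin n) :
    ∑ w ∈ Wᶜ, touches u v (fun x => b (x, w)) ≤ sharedAttrs b u + sharedAttrs b v := by
  classical
  have h : ∀ u : Fin n, (sharedAttrs b u : ℝ)
      = ∑ w, if b (u, w) = true ∧ ∃ z, z ≠ u ∧ b (z, w) = true then 1 else 0 := by
    intro u
    rw [Finset.sum_boole, sharedAttrs]
  rw [h, h, ← Finset.sum_add_distrib]
  calc ∑ w ∈ Wᶜ, touches u v (fun x => b (x, w)) ≤ ∑ w, touches u v (fun x => b (x, w)) :=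
        Finset.sum_le_sum_of_subset_of_nonneg (Finset.subset_univ _) fun w _ _ => by
          unfold touches; split_ifs <;> norm_num
    _ ≤ _ := Finset.sum_le_sum fun w _ => by
        unfold touches
        split_ifs with h1 h2 h3 h3 h2 h3 h3 <;> try norm_num
        obtain ⟨h | h, z, hzu, hzv, hz⟩ := h1
        · exact h2 ⟨h, z, hzu, hz⟩
        · exact h3 ⟨h, z, hzv, hz⟩

/-- The links in `F` are rarely present together with two vertices that share few attributes. -/
lemma linkLaw_pattern_small_le (p : unitInterval) {F : Finset (Fin n × Fin m)} {W : Finset (Fin m)}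
    (hF : ∀ e ∈ F, e.2 ∈ W) {u v : Fin n} (huv : u ≠ v) {θ : ℝ} (hθ : 0 ≤ θ) (t : ℝ) :
    linkLaw n m p {b | (∀ e ∈ F, b e = true) ∧ (sharedAttrs b u : ℝ) + sharedAttrs b v ≤ t}
      ≤ ENNReal.ofReal (Real.exp (θ * t) * ((p : ℝ) ^ F.card *
        Real.exp (-(1 - Real.exp (-θ)) *
          (1 - (1 - p : ℝ) ^ 2 - (1 - p : ℝ) ^ (n - 2) + (1 - p : ℝ) ^ n)) ^ (m - W.card))) := by
  have hnn : ∀ b : Links n m, ∀ w, 0 ≤ (if w ∈ W then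
        ∏ x, (if (x, w) ∈ F then (if b (x, w) = true then (1 : ℝ) else 0) else 1)
        else Real.exp (-θ * touches u v fun x => b (x, w))) := by
    intro b w
    split_ifs
    · exact Finset.prod_nonneg fun x _ => by split_ifs <;> norm_num
    · positivity
  -- Attributes in `W` carry only the pattern, the others only the Laplace transform, so the two
  -- constraints are independent.
  refine linkLaw_le p (f := fun b => Real.exp (θ * t) * ∏ w, if w ∈ W then
        ∏ x, (if (x, w) ∈ F then (if b (x, w) = true then 1 else 0) else 1)
        else Real.exp (-θ * touches u v fun x => b (x, w))) (fun b => ?_) (fun b hb => ?_) ?_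
  · exact mul_nonneg (Real.exp_pos _).le (Finset.prod_nonneg fun w _ => hnn b w)
  · rw [Finset.prod_ite, Finset.prod_eq_one, one_mul]
    · have : (Finset.univ.filter fun w => w ∉ W) = Wᶜ := by ext; simp
      rw [this, ← Real.exp_sum, ← Real.exp_add, ← Finset.mul_sum]
      refine Real.one_le_exp ?_
      have h1 := (sum_touches_le b W u v).trans hb.2
      have h2 := mul_le_mul_of_nonneg_left h1 hθ
      linarith
    · intro w _
      refine Finset.prod_eq_one fun x _ => ?_
      split_ifs with h1 h2
      · rfl
      · exact absurd (hb.1 _ h1) h2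
      · rfl
  · rw [linkMean_const_mul, linkMean_pattern (p : ℝ) hF
      (fun c => Real.exp (-θ * touches u v c))]
    have h0 : 0 ≤ linkMean (p : ℝ) (fun c => Real.exp (-θ * touches u v c)) := by
      have := linkMean_mono (p := (p : ℝ)) p.2.1 p.2.2
        (f := fun _ => 0 * 1) (g := fun c => Real.exp (-θ * touches u v c))
        fun c => by rw [zero_mul]; positivity
      rwa [linkMean_const_mul, zero_mul] at this
    have hp0 : (0 : ℝ) ≤ p := p.2.1
    have := linkMean_exp_touches_le (p : ℝ) huv θ
    gcongr

end Patterns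

/-! ### Union bounds over small subgraphs -/

section UnionBounds

variable {n m : ℕ}

lemma sum_pow_card_le (N K : ℕ) {x : ℝ} (hx : 0 ≤ x) :
    ∑ A ∈ Finset.univ.filter (fun A : Finset (Fin N) => A.card ≤ K), x ^ A.card
      ≤ (K + 1) * (1 + N * x) ^ K := by
  rw [← Finset.sum_fiberwise_of_maps_to (g := Finset.card) (t := Finset.range (K + 1))
    fun A hA => Finset.mem_range_succ_iff.2 (Finset.mem_filter.1 hA).2]
  have hNx : 0 ≤ N * x := by positivity
  have h : ∀ a ∈ Finset.range (K + 1),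
      ∑ A ∈ (Finset.univ.filter (fun A : Finset (Fin N) => A.card ≤ K)).filter (·.card = a),
        x ^ A.card ≤ (1 + N * x) ^ K := by
    intro a ha
    have h1 : ∀ A ∈ (Finset.univ.filter (fun A : Finset (Fin N) => A.card ≤ K)).filter (·.card = a),
        x ^ A.card = x ^ a := fun A hA => by rw [(Finset.mem_filter.1 hA).2]
    rw [Finset.sum_congr rfl h1, Finset.sum_const, nsmul_eq_mul]
    have h2 : ((Finset.univ.filter (fun A : Finset (Fin N) => A.card ≤ K)).filter (·.card = a)).card
        ≤ N ^ a := by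
      refine le_trans (Finset.card_le_card (t := Finset.powersetCard a Finset.univ) ?_) ?_
      · intro A hA
        exact Finset.mem_powersetCard.2 ⟨Finset.subset_univ _, (Finset.mem_filter.1 hA).2⟩
      · rw [Finset.card_powersetCard, Finset.card_univ, Fintype.card_fin]
        exact Nat.choose_le_pow N a
    calc _ ≤ ((N ^ a : ℕ) : ℝ) * x ^ a := by gcongr
      _ = (N * x) ^ a := by push_cast; rw [mul_pow]
      _ ≤ (1 + N * x) ^ a := pow_le_pow_left₀ hNx (by linarith) a
      _ ≤ (1 + N * x) ^ K := pow_le_pow_right₀ (by linarith) (Finset.mem_range_succ_iff.1 ha)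
  refine (Finset.sum_le_sum h).trans ?_
  rw [Finset.sum_const, Finset.card_range, nsmul_eq_mul]
  push_cast
  rfl

/-- A union bound over small sets of vertices and attributes, and the links between them. -/
lemma linkLaw_iUnion_pattern_le (p : unitInterval) (K : ℕ) {E : Set (Links n m)}
    (D : Finset (Fin n) → Finset (Fin m) → Finset (Fin n × Fin m) → Set (Links n m)) {η : ℝ}
    (hη : 0 ≤ η)
    (hE : ∀ b ∈ E, ∃ A W F, A.card ≤ K ∧ W.card ≤ K ∧ F ⊆ A ×ˢ W ∧ b ∈ D A W F)
    (hD : ∀ A W F, A.card ≤ K → W.card ≤ K → F ⊆ A ×ˢ W →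
      linkLaw n m p (D A W F) ≤ ENNReal.ofReal ((p : ℝ) ^ A.card * (p : ℝ) ^ W.card * η)) :
    linkLaw n m p E ≤ ENNReal.ofReal
      (((K + 1) * (1 + n * p) ^ K) * ((K + 1) * (1 + m * p) ^ K) * (2 ^ (K * K) * η)) := by
  classical
  have hp0 : (0 : ℝ) ≤ p := p.2.1
  set IA := Finset.univ.filter (fun A : Finset (Fin n) => A.card ≤ K)
  set IW := Finset.univ.filter (fun A : Finset (Fin m) => A.card ≤ K)
  have hsub : E ⊆ ⋃ A ∈ IA, ⋃ W ∈ IW, ⋃ F ∈ (A ×ˢ W).powerset, D A W F := by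
    intro b hb
    obtain ⟨A, W, F, hA, hW, hF, hbD⟩ := hE b hb
    simp only [Set.mem_iUnion]
    exact ⟨A, by simp [IA, hA], W, by simp [IW, hW], F, Finset.mem_powerset.2 hF, hbD⟩
  have h1 : linkLaw n m p E ≤ ∑ A ∈ IA, ∑ W ∈ IW, ENNReal.ofReal
      ((p : ℝ) ^ A.card * (p : ℝ) ^ W.card * (2 ^ (K * K) * η)) := by
    refine (measure_mono hsub).trans ((measure_biUnion_finset_le _ _).trans
      (Finset.sum_le_sum fun A hA => (measure_biUnion_finset_le _ _).trans
        (Finset.sum_le_sum fun W hW => (measure_biUnion_finset_le _ _).trans ?_)))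
    have hA' : A.card ≤ K := (Finset.mem_filter.1 hA).2
    have hW' : W.card ≤ K := (Finset.mem_filter.1 hW).2
    refine (Finset.sum_le_sum fun F hF => hD A W F hA' hW' (Finset.mem_powerset.1 hF)).trans ?_
    rw [← ENNReal.ofReal_sum_of_nonneg (fun _ _ => by positivity), Finset.sum_const, nsmul_eq_mul,
      Finset.card_powerset, Finset.card_product]
    refine ENNReal.ofReal_le_ofReal ?_
    -- The factor 2^(K²) bounds the number of link patterns F ⊆ A × W.
    have h2 : ((2 ^ (A.card * W.card) : ℕ) : ℝ) ≤ 2 ^ (K * K) := by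
      push_cast
      exact pow_le_pow_right₀ one_le_two (Nat.mul_le_mul hA' hW')
    calc _ ≤ 2 ^ (K * K) * ((p : ℝ) ^ A.card * (p : ℝ) ^ W.card * η) := by gcongr
      _ = _ := by ring
  refine h1.trans ?_
  have h2 : ∑ A ∈ IA, ∑ W ∈ IW, ENNReal.ofReal
      ((p : ℝ) ^ A.card * (p : ℝ) ^ W.card * (2 ^ (K * K) * η)) = ENNReal.ofReal
      (∑ A ∈ IA, ∑ W ∈ IW, (p : ℝ) ^ A.card * (p : ℝ) ^ W.card * (2 ^ (K * K) * η)) := by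
    rw [ENNReal.ofReal_sum_of_nonneg (fun _ _ => Finset.sum_nonneg fun _ _ => by positivity)]
    exact Finset.sum_congr rfl fun A _ =>
      (ENNReal.ofReal_sum_of_nonneg fun _ _ => by positivity).symm
  rw [h2]
  refine ENNReal.ofReal_le_ofReal ?_
  have h3 : ∑ A ∈ IA, ∑ W ∈ IW, (p : ℝ) ^ A.card * (p : ℝ) ^ W.card * (2 ^ (K * K) * η)
      = (∑ A ∈ IA, (p : ℝ) ^ A.card) * (∑ W ∈ IW, (p : ℝ) ^ W.card) * (2 ^ (K * K) * η) := by
    rw [Finset.sum_mul_sum, Finset.sum_mul]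
    refine Finset.sum_congr rfl fun A _ => ?_
    rw [Finset.sum_mul]
  rw [h3]
  have h4 := sum_pow_card_le n K hp0
  have h5 := sum_pow_card_le m K hp0
  have h6 : 0 ≤ ∑ W ∈ IW, (p : ℝ) ^ W.card := Finset.sum_nonneg fun _ _ => by positivity
  gcongr

/-- A violating set with a vertices and w attributes contains a pattern of exactly a + w + 1 links:
one factor p beyond what the choice of nodes consumes. -/
lemma linkLaw_not_locallySparse_le (p : unitInterval) (K : ℕ) :
    linkLaw n m p {b | ¬ LocallySparse b K} ≤ ENNReal.ofReal
      (((K + 1) * (1 + n * p) ^ K) * ((K + 1) * (1 + m * p) ^ K) * (2 ^ (K * K) * p)) := by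
  classical
  refine linkLaw_iUnion_pattern_le p K (fun A W F => {b | F.card = A.card + W.card + 1 ∧
    ∀ e ∈ F, b e = true}) p.2.1 (fun b hb => ?_) fun A W F _ _ _ => ?_
  · have hb' : ¬ LocallySparse b K := hb
    unfold LocallySparse at hb'
    push Not at hb'
    obtain ⟨U, hU, hlt⟩ := hb'
    obtain ⟨F, hF, hFcard⟩ := Finset.exists_subset_card_eq (Nat.succ_le_of_lt hlt)
    have hcard := Finset.card_toLeft_add_card_toRight (u := U)
    refine ⟨U.toLeft, U.toRight, F, by omega, by omega, fun e he => ?_, ?_, fun e he => ?_⟩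
    · have := (mem_spannedLinks b).1 (hF he)
      rw [Finset.mem_product, Finset.mem_toLeft, Finset.mem_toRight]
      exact this.2
    · rw [hcard]; exact hFcard
    · exact ((mem_spannedLinks b).1 (hF he)).1
  · by_cases hc : F.card = A.card + W.card + 1
    · refine (measure_mono fun b hb => hb.2).trans ((linkLaw_pattern_le p F).trans ?_)
      rw [hc, pow_succ, pow_add]
    · have : {b : Links n m | F.card = A.card + W.card + 1 ∧ ∀ e ∈ F, b e = true} = ∅ := by
        ext b; simp [hc]
      rw [this, measure_empty]
      exact zero_le

lemma mem_nearSet_of_walk {V : Type} {G : SimpleGraph V} {u v : V} (q : G.Walk u v) {j : ℕ}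
    (hq : q.length ≤ j) : u ∈ nearSet G {v} (j + 1) := by
  induction q generalizing j with
  | nil => exact subset_nearSet_succ _ _ rfl
  | cons h q ih =>
    rw [SimpleGraph.Walk.length_cons] at hq
    obtain ⟨i, rfl⟩ : ∃ i, j = i + 1 := ⟨j - 1, by omega⟩
    exact nearSet_succ_of_adj h (ih (by omega))

lemma mem_nearSet_of_edist_le {V : Type} {G : SimpleGraph V} {u v : V} {j : ℕ}
    (h : G.edist u v ≤ j) : u ∈ nearSet G {v} (j + 1) := by
  have hne : G.edist u v ≠ ⊤ := ne_top_of_le_ne_top (ENat.natCast_ne_top j) h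
  obtain ⟨q, hq⟩ := SimpleGraph.exists_walk_of_edist_ne_top hne
  exact mem_nearSet_of_walk q (by rw [← hq] at h; exact_mod_cast h)

/-- A path of length at most 10 becomes a connected set of at most 21 bipartite nodes, carrying at
least one link fewer than nodes. The missing link costs `p⁻¹`, to be beaten by `B`; K² counts the
choices of the two ends. -/
lemma linkLaw_close_small_le (p : unitInterval) (hp : 0 < (p : ℝ)) (K : ℕ) (hK : 21 ≤ K) {s θ B : ℝ}
    (hθ : 0 ≤ θ)
    (hB : ∀ b ≤ K, Real.exp (-(1 - Real.exp (-θ)) *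
          (1 - (1 - p : ℝ) ^ 2 - (1 - p : ℝ) ^ (n - 2) + (1 - p : ℝ) ^ n)) ^ (m - b) ≤ B) :
    linkLaw n m p {b | ∃ u v, u ≠ v ∧ (sharedAttrs b u : ℝ) < s ∧ (sharedAttrs b v : ℝ) < s ∧
        (interGraph b).edist u v ≤ 10} ≤ ENNReal.ofReal
      (((K + 1) * (1 + n * p) ^ K) * ((K + 1) * (1 + m * p) ^ K) * (2 ^ (K * K) *
        (K * K * (Real.exp (θ * (2 * s)) * ((p : ℝ)⁻¹ * B))))) := by
  classical
  have hB0 : 0 ≤ B := le_trans (by positivity) (hB 0 (Nat.zero_le _))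
  refine linkLaw_iUnion_pattern_le p K (fun A W F => ⋃ u ∈ A, ⋃ v ∈ A,
    {b | u ≠ v ∧ F.card + 1 = A.card + W.card ∧ (∀ e ∈ F, b e = true) ∧
      (sharedAttrs b u : ℝ) + sharedAttrs b v ≤ 2 * s}) (by positivity) (fun b hb => ?_)
    fun A W F hA hW hF => ?_
  · obtain ⟨u, v, huv, hu, hv, hd⟩ := hb
    obtain ⟨z, hz, q, hq, -, -⟩ := exists_walk_of_mem_nearSet
      (mem_nearSet_of_edist_le (j := 10) (by exact_mod_cast hd))
    have hzv : z = v := hz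
    subst hzv
    set U := q.support.toFinset with hU
    have hconn : ((incidence b).induce (U : Set (Fin n ⊕ Fin m))).Connected := by
      have : (U : Set (Fin n ⊕ Fin m)) = {v | v ∈ q.support} := by ext; simp [hU]
      rw [this]
      exact q.connected_induce_support
    have hcard := card_le_card_spannedLinks_add_one b hconn
    have hUcard : U.card ≤ 21 := by
      have := q.support.toFinset_card_le
      rw [SimpleGraph.Walk.length_support] at this
      rw [hU]
      omega
    have hpos : 0 < U.card := Finset.card_pos.2 ⟨.inl u, by simp [hU]⟩
    obtain ⟨F, hF, hFcard⟩ := Finset.exists_subset_card_eq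
      (show U.card - 1 ≤ (spannedLinks b U).card by omega)
    have hLR := Finset.card_toLeft_add_card_toRight (u := U)
    refine ⟨U.toLeft, U.toRight, F, by omega, by omega, fun e he => ?_, ?_⟩
    · have := (mem_spannedLinks b).1 (hF he)
      rw [Finset.mem_product, Finset.mem_toLeft, Finset.mem_toRight]
      exact this.2
    · simp only [Set.mem_iUnion]
      refine ⟨u, by simp [hU], z, by simp [hU], huv, by omega, fun e he => ?_, by linarith⟩
      exact ((mem_spannedLinks b).1 (hF he)).1
  · have hone : ∀ u v, linkLaw n m p {b | u ≠ v ∧ F.card + 1 = A.card + W.card ∧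
        (∀ e ∈ F, b e = true) ∧ (sharedAttrs b u : ℝ) + sharedAttrs b v ≤ 2 * s}
        ≤ ENNReal.ofReal ((p : ℝ) ^ A.card * (p : ℝ) ^ W.card *
          (Real.exp (θ * (2 * s)) * ((p : ℝ)⁻¹ * B))) := by
      intro u v
      by_cases hc : u ≠ v ∧ F.card + 1 = A.card + W.card
      · refine (measure_mono fun b hb => hb.2.2).trans ((linkLaw_pattern_small_le p (W := W)
          (fun e he => (Finset.mem_product.1 (hF he)).2) hc.1 hθ (2 * s)).trans
            (ENNReal.ofReal_le_ofReal ?_))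
        have h1 : (p : ℝ) ^ A.card * (p : ℝ) ^ W.card = (p : ℝ) ^ F.card * p := by
          rw [← pow_add, ← hc.2, pow_succ]
        rw [h1]
        have h2 := hB W.card hW
        calc _ ≤ Real.exp (θ * (2 * s)) * ((p : ℝ) ^ F.card * B) := by gcongr
          _ = _ := by field_simp
      · have : {b : Links n m | u ≠ v ∧ F.card + 1 = A.card + W.card ∧
            (∀ e ∈ F, b e = true) ∧ (sharedAttrs b u : ℝ) + sharedAttrs b v ≤ 2 * s} = ∅ := by
          ext b
          simp only [Set.mem_ofPred_eq, Set.mem_empty_iff_false, iff_false]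
          exact fun h => hc ⟨h.1, h.2.1⟩
        rw [this, measure_empty]
        exact zero_le
    refine (measure_biUnion_finset_le _ _).trans ((Finset.sum_le_sum fun u _ =>
      (measure_biUnion_finset_le _ _).trans (Finset.sum_le_sum fun v _ => hone u v)).trans ?_)
    rw [Finset.sum_const, Finset.sum_const, nsmul_eq_mul, nsmul_eq_mul,
      ← ENNReal.ofReal_natCast, ← ENNReal.ofReal_mul (Nat.cast_nonneg _),
      ← ENNReal.ofReal_mul (Nat.cast_nonneg _)]
    refine ENNReal.ofReal_le_ofReal ?_
    have hA' : (A.card : ℝ) ≤ K := by exact_mod_cast hA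
    calc _ ≤ (K : ℝ) * (K * ((p : ℝ) ^ A.card * (p : ℝ) ^ W.card *
          (Real.exp (θ * (2 * s)) * ((p : ℝ)⁻¹ * B)))) := by gcongr
      _ = _ := by ring

end UnionBounds

/-! ### Quantitative failure probabilities, with n = e^L -/

section Rates

variable {n m : ℕ} {p : unitInterval} {l₀ l₁ M L c : ℝ}

lemma one_sub_pow_le_exp {x : ℝ} (hx : x ≤ 1) (k : ℕ) : (1 - x) ^ k ≤ Real.exp (-(x * k)) := by
  rw [show -(x * k) = k * -x by ring, Real.exp_nat_mul]
  exact pow_le_pow_left₀ (by linarith) (by linarith [Real.add_one_le_exp (-x)]) k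

lemma one_add_pow_le_exp {x : ℝ} (hx : 0 ≤ x) (k : ℕ) : (1 + x) ^ k ≤ Real.exp (x * k) := by
  rw [mul_comm, Real.exp_nat_mul]
  exact pow_le_pow_left₀ (by linarith) (by linarith [Real.add_one_le_exp x]) k

lemma linkLaw_exists_deg_gt_le (hL : Real.exp L = n) (hnp : (n : ℝ) * p ≤ l₁)
    (hmp : (m : ℝ) * p ≤ M * L) :
    linkLaw n m p {b | ∃ v, ¬ (deg (interGraph b) v : ℝ) ≤ (M * Real.exp (2 * l₁) + 2) * L}
      ≤ ENNReal.ofReal (Real.exp (-L)) := by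
  have hp0 : (0 : ℝ) ≤ p := p.2.1
  have hsub : {b : Links n m | ∃ v, ¬ (deg (interGraph b) v : ℝ) ≤ (M * Real.exp (2 * l₁) + 2) * L}
      ⊆ ⋃ v ∈ (Finset.univ : Finset (Fin n)),
        {b | (M * Real.exp (2 * l₁) + 2) * L ≤ deg (interGraph b) v} := by
    rintro b ⟨v, hv⟩
    simp only [Set.mem_iUnion]
    exact ⟨v, Finset.mem_univ v, (not_le.1 hv).le⟩
  refine (measure_mono hsub).trans ((measure_biUnion_finset_le _ _).trans
    ((Finset.sum_le_sum fun v _ => linkLaw_deg_ge_le p v _).trans ?_))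
  rw [Finset.sum_const, Finset.card_univ, Fintype.card_fin, nsmul_eq_mul, ← ENNReal.ofReal_natCast,
    ← ENNReal.ofReal_mul (Nat.cast_nonneg _), ← hL]
  refine ENNReal.ofReal_le_ofReal ?_
  have he : Real.exp 1 ≤ 3 := by linarith [Real.exp_one_lt_d9]
  have he1 : 1 ≤ Real.exp 1 := Real.one_le_exp zero_le_one
  have h1 : ((p : ℝ) * Real.exp 1 + (1 - p)) ^ (n - 1) ≤ Real.exp (2 * l₁) := by
    have hx : 0 ≤ (p : ℝ) * (Real.exp 1 - 1) := mul_nonneg hp0 (by linarith)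
    rw [show (p : ℝ) * Real.exp 1 + (1 - p) = 1 + p * (Real.exp 1 - 1) by ring]
    refine (one_add_pow_le_exp hx _).trans (Real.exp_le_exp.2 ?_)
    have h2 : ((n - 1 : ℕ) : ℝ) ≤ n := by exact_mod_cast Nat.sub_le n 1
    calc (p : ℝ) * (Real.exp 1 - 1) * (n - 1 : ℕ) ≤ p * 2 * n := by gcongr; linarith
      _ = 2 * (n * p) := by ring
      _ ≤ 2 * l₁ := by linarith
  have h0 : 0 ≤ ((p : ℝ) * Real.exp 1 + (1 - p)) ^ (n - 1) :=
    pow_nonneg (by have := p.2.2; nlinarith) _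
  have h2 : ((p : ℝ) * (p * Real.exp 1 + (1 - p)) ^ (n - 1) + (1 - p)) ^ m
      ≤ Real.exp (M * L * Real.exp (2 * l₁)) := by
    have h3 : (p : ℝ) * (p * Real.exp 1 + (1 - p)) ^ (n - 1) + (1 - p)
        ≤ 1 + p * Real.exp (2 * l₁) := by nlinarith
    refine (pow_le_pow_left₀ (add_nonneg (mul_nonneg hp0 h0) (by linarith [p.2.2])) h3 m).trans ?_
    refine (one_add_pow_le_exp (by positivity) _).trans (Real.exp_le_exp.2 ?_)
    calc (p : ℝ) * Real.exp (2 * l₁) * m = (m * p) * Real.exp (2 * l₁) := by ring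
      _ ≤ _ := by gcongr
  -- The threshold is the exponential moment rate plus 2L: one L pays for the union over vertices,
  -- the other remains.
  calc _ ≤ Real.exp L * (Real.exp (-((M * Real.exp (2 * l₁) + 2) * L)) *
        Real.exp (M * L * Real.exp (2 * l₁))) := by gcongr
    _ = Real.exp (-L) := by
        rw [← Real.exp_add, ← Real.exp_add]; congr 1; ring

lemma linkLaw_exists_attr_gt_le (hL : Real.exp L = n) (hL0 : 0 ≤ L) (hl₀ : 0 < l₀)
    (hnp₀ : l₀ ≤ (n : ℝ) * p) (hnp : (n : ℝ) * p ≤ l₁)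
    (hM0 : 0 ≤ M) (hmp : (m : ℝ) * p ≤ M * L) {κ : ℝ} (hκ : 0 < κ) :
    linkLaw n m p {b | ∃ w, ¬ ((Finset.univ.filter fun v => b (v, w) = true).card : ℝ) ≤ κ * L}
      ≤ ENNReal.ofReal (M / l₀ * Real.exp (l₁ * Real.exp (3 / κ)) * Real.exp (-L)) := by
  have hp0 : (0 : ℝ) ≤ p := p.2.1
  have hn0 : (0 : ℝ) < n := hL ▸ Real.exp_pos L
  have hp : (0 : ℝ) < p := by
    rcases hp0.lt_or_eq with h | h
    · exact h
    · rw [← h, mul_zero] at hnp₀; linarith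
  have hsub : {b : Links n m | ∃ w, ¬ ((Finset.univ.filter fun v => b (v, w) = true).card : ℝ)
        ≤ κ * L}
      ⊆ ⋃ w ∈ (Finset.univ : Finset (Fin m)),
        {b | 3 / κ * (κ * L) ≤ 3 / κ * (Finset.univ.filter fun v => b (v, w) = true).card} := by
    rintro b ⟨w, hw⟩
    simp only [Set.mem_iUnion]
    exact ⟨w, Finset.mem_univ w, mul_le_mul_of_nonneg_left (not_le.1 hw).le (by positivity)⟩
  refine (measure_mono hsub).trans ((measure_biUnion_finset_le _ _).trans
    ((Finset.sum_le_sum fun w _ => linkLaw_attr_ge_le p w _ _).trans ?_))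
  rw [Finset.sum_const, Finset.card_univ, Fintype.card_fin, nsmul_eq_mul, ← ENNReal.ofReal_natCast,
    ← ENNReal.ofReal_mul (Nat.cast_nonneg _)]
  refine ENNReal.ofReal_le_ofReal ?_
  -- Chosen so that the Chernoff factor is e^{-3L}, against at most (M/l₀) e^{2L} attributes.
  set θ := 3 / κ with hθ
  have hθ0 : 0 ≤ θ := by positivity
  have hθκ : θ * (κ * L) = 3 * L := by rw [hθ]; field_simp
  have hML : 0 ≤ M * L := le_trans (by positivity) hmp
  have h1 : ((p : ℝ) * Real.exp θ + (1 - p)) ^ n ≤ Real.exp (l₁ * Real.exp θ) := by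
    have h2 : (p : ℝ) * Real.exp θ + (1 - p) ≤ 1 + p * Real.exp θ := by linarith
    refine (pow_le_pow_left₀ (add_nonneg (by positivity) (by linarith [p.2.2])) h2 n).trans ?_
    refine (one_add_pow_le_exp (by positivity) _).trans (Real.exp_le_exp.2 ?_)
    calc (p : ℝ) * Real.exp θ * n = (n * p) * Real.exp θ := by ring
      _ ≤ _ := by gcongr
  have h3 : (m : ℝ) ≤ M / l₀ * L * Real.exp L := by
    rw [hL]
    have h4 : (m : ℝ) * l₀ ≤ M * L * n := by
      calc (m : ℝ) * l₀ ≤ m * (n * p) := by gcongr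
        _ = (m * p) * n := by ring
        _ ≤ M * L * n := by gcongr
    rw [div_mul_eq_mul_div, div_mul_eq_mul_div, le_div_iff₀ hl₀]
    exact h4
  have h5 : L ≤ Real.exp L := by linarith [Real.add_one_le_exp L]
  have hM : 0 ≤ M / l₀ * L := by rw [div_mul_eq_mul_div]; positivity
  rw [hθκ]
  calc (m : ℝ) * (Real.exp (-(3 * L)) * (p * Real.exp θ + (1 - p)) ^ n)
      ≤ (M / l₀ * L * Real.exp L) * (Real.exp (-(3 * L)) * Real.exp (l₁ * Real.exp θ)) := by
        gcongr
        exact mul_nonneg (Real.exp_pos _).le (pow_nonneg (add_nonneg (mul_nonneg hp0 (Real.exp_pos θ).le) (sub_nonneg.2 p.2.2)) _)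
    _ ≤ (M / l₀ * Real.exp L * Real.exp L) * (Real.exp (-(3 * L)) * Real.exp (l₁ * Real.exp θ)) := by
        gcongr
    _ = M / l₀ * Real.exp (l₁ * Real.exp θ) * Real.exp (-L) := by
        rw [show -L = L + L + -(3 * L) by ring, Real.exp_add, Real.exp_add]; ring

lemma linkLaw_exists_isolated_le (hL : Real.exp L = n)
    (hthr : (m : ℝ) * p * (1 - (1 - (p : ℝ)) ^ (n - 1)) = c * L) :
    linkLaw n m p {b | ∃ v, ¬ 0 < deg (interGraph b) v}
      ≤ ENNReal.ofReal (Real.exp (-((c - 1) * L))) := by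
  have hp0 : (0 : ℝ) ≤ p := p.2.1
  have hsub : {b : Links n m | ∃ v, ¬ 0 < deg (interGraph b) v}
      ⊆ ⋃ v ∈ (Finset.univ : Finset (Fin n)), {b | deg (interGraph b) v = 0} := by
    rintro b ⟨v, hv⟩
    simp only [Set.mem_iUnion]
    exact ⟨v, Finset.mem_univ v, Nat.eq_zero_of_not_pos hv⟩
  refine (measure_mono hsub).trans ((measure_biUnion_finset_le _ _).trans
    ((Finset.sum_le_sum fun v _ => linkLaw_deg_eq_zero_le p v).trans ?_))
  rw [Finset.sum_const, Finset.card_univ, Fintype.card_fin, nsmul_eq_mul, ← ENNReal.ofReal_natCast,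
    ← ENNReal.ofReal_mul (Nat.cast_nonneg _), ← hL]
  refine ENNReal.ofReal_le_ofReal ?_
  have h1 : (p : ℝ) * (1 - p) ^ (n - 1) + (1 - p) = 1 - p * (1 - (1 - p) ^ (n - 1)) := by ring
  have h2 : (1 - (p : ℝ)) ^ (n - 1) ≤ 1 := pow_le_one₀ (by linarith [p.2.2]) (by linarith)
  have h3 : 0 ≤ (1 - (p : ℝ)) ^ (n - 1) := pow_nonneg (by linarith [p.2.2]) _
  have h4 : (p : ℝ) * (1 - (1 - p) ^ (n - 1)) ≤ 1 := mul_le_one₀ p.2.2 (by linarith) (by linarith)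
  rw [h1]
  calc _ ≤ Real.exp L * Real.exp (-(p * (1 - (1 - p) ^ (n - 1)) * m)) := by
        gcongr; exact one_sub_pow_le_exp h4 m
    _ = Real.exp (-((c - 1) * L)) := by
        rw [← Real.exp_add]; congr 1
        rw [show (p : ℝ) * (1 - (1 - p) ^ (n - 1)) * m = m * p * (1 - (1 - p) ^ (n - 1)) by ring, hthr]
        ring

lemma linkLaw_not_sparse_le (hL : Real.exp L = n) (hnp : (n : ℝ) * p ≤ l₁)
    (hmp : (m : ℝ) * p ≤ M * L) (K : ℕ) :
    linkLaw n m p {b | ¬ LocallySparse b K} ≤ ENNReal.ofReal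
      ((K + 1) ^ 2 * (1 + l₁) ^ K * 2 ^ (K * K) * l₁ * ((1 + M * L) ^ K * Real.exp (-L))) := by
  have hp0 : (0 : ℝ) ≤ p := p.2.1
  refine (linkLaw_not_locallySparse_le p K).trans (ENNReal.ofReal_le_ofReal ?_)
  have h1 : (p : ℝ) ≤ l₁ * Real.exp (-L) := by
    rw [Real.exp_neg, ← div_eq_mul_inv, le_div_iff₀ (Real.exp_pos L), hL, mul_comm]
    exact hnp
  calc _ ≤ ((K + 1) * (1 + l₁) ^ K) * ((K + 1) * (1 + M * L) ^ K)
        * (2 ^ (K * K) * (l₁ * Real.exp (-L))) := by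
        have h2 : 0 ≤ l₁ := le_trans (by positivity) hnp
        have h3 : 0 ≤ M * L := le_trans (by positivity) hmp
        gcongr
    _ = _ := by ring

/-- The expected number of attributes joining {u, v} to the rest is nearly 2cL, hence at least 1.9 L
after all losses; as 1 − e^{-3} ≥ 0.9, the exponent is at least 1.71 L. -/
lemma touch_rate_le (hL0 : 20 ≤ L) (hc : 1 ≤ c) (hp1 : (p : ℝ) ≤ 1 / 100) (hMp : M * p ≤ 1 / 100)
    (hn : 2 ≤ n) (hmp : (m : ℝ) * p ≤ M * L)
    (hthr : (m : ℝ) * p * (1 - (1 - (p : ℝ)) ^ (n - 1)) = c * L) {k : ℕ} (hk : k ≤ 40) :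
    Real.exp (-(1 - Real.exp (-3)) *
      (1 - (1 - p : ℝ) ^ 2 - (1 - p : ℝ) ^ (n - 2) + (1 - p : ℝ) ^ n)) ^ (m - k)
      ≤ Real.exp (-(17 / 10) * L) := by
  have hp0 : (0 : ℝ) ≤ p := p.2.1
  set x : ℝ := (p : ℝ)
  set y := (1 - x) ^ (n - 2) with hy
  have hy0 : 0 ≤ y := pow_nonneg (by linarith) _
  have hy1 : y ≤ 1 := pow_le_one₀ (by linarith) (by linarith)
  have hyn1 : (1 - x) ^ (n - 1) = y * (1 - x) := by
    rw [hy, ← pow_succ]; congr 1; omega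
  have hyn : (1 - x) ^ n = y * (1 - x) ^ 2 := by
    rw [hy, ← pow_add]; congr 1; omega
  rw [hyn1] at hthr
  rw [hyn, ← Real.exp_nat_mul, Real.exp_le_exp]
  set ζ := 1 - (1 - x) ^ 2 - y + y * (1 - x) ^ 2 with hζ
  have hζ' : ζ = x * (2 - x) * (1 - y) := by rw [hζ]; ring
  have hζ0 : 0 ≤ ζ := by
    rw [hζ']; exact mul_nonneg (mul_nonneg hp0 (by linarith)) (by linarith)
  have hζ1 : ζ ≤ 2 * x := by
    rw [hζ']
    have : x * (2 - x) ≤ 2 * x := by nlinarith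
    calc x * (2 - x) * (1 - y) ≤ 2 * x * 1 :=
          mul_le_mul this (by linarith) (by linarith) (by linarith)
      _ = 2 * x := mul_one _
  have hmx0 : 0 ≤ (m : ℝ) * x := by positivity
  have h1 : 99 / 100 * L ≤ m * x * (1 - y) := by
    -- The threshold involves the exponent n − 1 rather than n − 2; the difference is at most (Mp)L.
    have h2 : m * x * (1 - y) = c * L - m * x * (y * x) := by rw [← hthr]; ring
    have h3 : m * x * (y * x) ≤ 1 / 100 * L := by
      calc m * x * (y * x) ≤ (m * x) * (1 * x) := by gcongr
        _ ≤ (M * L) * (1 * x) := by gcongr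
        _ = (M * x) * L := by ring
        _ ≤ 1 / 100 * L := by gcongr
    nlinarith
  have h4 : 199 / 100 * (99 / 100 * L) ≤ m * ζ := by
    have : m * ζ = (2 - x) * (m * x * (1 - y)) := by rw [hζ']; ring
    rw [this]
    exact mul_le_mul (by linarith) h1 (by positivity) (by linarith)
  have h5 : (m : ℝ) - 40 ≤ ((m - k : ℕ) : ℝ) := by
    have : m ≤ (m - k) + 40 := by omega
    have : (m : ℝ) ≤ ((m - k : ℕ) : ℝ) + 40 := by exact_mod_cast this
    linarith
  -- Discarding at most 40 attributes costs at most 40 · 2p ≤ 0.8, absorbed by 0.07 L since L ≥ 20.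
  have h6 : (19 / 10) * L ≤ ((m - k : ℕ) : ℝ) * ζ := by
    have h7 := mul_le_mul_of_nonneg_right h5 hζ0
    nlinarith
  have he : Real.exp (-3) ≤ 1 / 10 := by
    rw [Real.exp_neg, inv_eq_one_div]
    refine one_div_le_one_div_of_le (by norm_num) ?_
    have h8 : (2.7 : ℝ) ≤ Real.exp 1 := by linarith [Real.exp_one_gt_d9]
    have h9 : Real.exp 3 = Real.exp 1 ^ 3 := by rw [← Real.exp_nat_mul]; norm_num
    rw [h9]
    calc (10 : ℝ) ≤ 2.7 ^ 3 := by norm_num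
      _ ≤ _ := pow_le_pow_left₀ (by norm_num) h8 3
  have h10 : 9 / 10 * ((19 / 10) * L) ≤ (1 - Real.exp (-3)) * (((m - k : ℕ) : ℝ) * ζ) :=
    mul_le_mul (by linarith) h6 (by linarith) (by linarith)
  nlinarith

lemma linkLaw_not_separated_le (hL : Real.exp L = n) (hL0 : 20 ≤ L) (hc : 1 ≤ c) (hl₀ : 0 < l₀)
    (hnp₀ : l₀ ≤ (n : ℝ) * p) (hnp : (n : ℝ) * p ≤ l₁)
    (hp1 : (p : ℝ) ≤ 1 / 100) (hMp : M * p ≤ 1 / 100) (hmp : (m : ℝ) * p ≤ M * L)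
    (hthr : (m : ℝ) * p * (1 - (1 - (p : ℝ)) ^ (n - 1)) = c * L)
    {K : ℕ} (hK : 21 ≤ K) (hK' : K ≤ 40) :
    linkLaw n m p {b | ∃ u v, u ≠ v ∧ (sharedAttrs b u : ℝ) < 1 / 60 * L ∧
      (sharedAttrs b v : ℝ) < 1 / 60 * L ∧ (interGraph b).edist u v ≤ 10} ≤ ENNReal.ofReal
      ((K + 1) ^ 2 * (1 + l₁) ^ K * 2 ^ (K * K) * (K * K) / l₀
        * ((1 + M * L) ^ K * Real.exp (-(1 / 2) * L))) := by
  have hp0 : (0 : ℝ) ≤ p := p.2.1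
  have hn0 : (0 : ℝ) < n := hL ▸ Real.exp_pos L
  have hp : (0 : ℝ) < p := by
    rcases hp0.lt_or_eq with h | h
    · exact h
    · rw [← h, mul_zero] at hnp₀; linarith
  have hn : 2 ≤ n := by
    have : (2 : ℝ) ≤ n := by rw [← hL]; linarith [Real.add_one_le_exp L]
    exact_mod_cast this
  refine (linkLaw_close_small_le p hp K hK (θ := 3) (by norm_num)
    fun k hk => touch_rate_le hL0 hc hp1 hMp hn hmp hthr (hk.trans hK')).trans (ENNReal.ofReal_le_ofReal ?_)
  have h1 : (p : ℝ)⁻¹ ≤ Real.exp L / l₀ := by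
    rw [hL, inv_eq_one_div, div_le_div_iff₀ hp hl₀, one_mul]
    exact hnp₀
  have h2 : 0 ≤ l₁ := le_trans (by positivity) hnp
  have h3 : 0 ≤ M * L := le_trans (by positivity) hmp
  calc _ ≤ (((K : ℝ) + 1) * (1 + l₁) ^ K) * ((K + 1) * (1 + M * L) ^ K) * (2 ^ (K * K) *
        (K * K * (Real.exp (3 * (2 * (1 / 60 * L))) *
          (Real.exp L / l₀ * Real.exp (-(17 / 10) * L))))) := by gcongr
    _ = ((K : ℝ) + 1) ^ 2 * (1 + l₁) ^ K * 2 ^ (K * K) * (K * K) / l₀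
        * ((1 + M * L) ^ K * (Real.exp (3 * (2 * (1 / 60 * L))) * Real.exp L
          * Real.exp (-(17 / 10) * L))) := by ring
    _ ≤ _ := by
        -- The exponents add up to 1/10 + 1 − 17/10 = −3/5: smallness threshold, lost factor 1/p,
        -- touch rate.
        rw [← Real.exp_add, ← Real.exp_add]
        gcongr
        linarith

end Rates

/-! ### Typicality holds with high probability -/

section Typicality

lemma linkLaw_not_isTypical_le {n m : ℕ} {p : unitInterval} {l₀ l₁ M L c : ℝ}
    (hL : Real.exp L = n) (hL0 : 20 ≤ L) (hc : 1 ≤ c) (hl₀ : 0 < l₀)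
    (hnp₀ : l₀ ≤ (n : ℝ) * p) (hnp : (n : ℝ) * p ≤ l₁)
    (hp1 : (p : ℝ) ≤ 1 / 100) (hM0 : 0 ≤ M) (hMp : M * p ≤ 1 / 100) (hmp : (m : ℝ) * p ≤ M * L)
    (hthr : (m : ℝ) * p * (1 - (1 - (p : ℝ)) ^ (n - 1)) = c * L)
    {K : ℕ} (hK : 21 ≤ K) (hK' : K = 40) :
    linkLaw n m p {b | ¬ IsTypical b L (1 / 60) (M * Real.exp (2 * l₁) + 2)}
      ≤ ENNReal.ofReal
          ((K + 1) ^ 2 * (1 + l₁) ^ K * 2 ^ (K * K) * l₁ * ((1 + M * L) ^ K * Real.exp (-L)))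
        + (ENNReal.ofReal (Real.exp (-L))
        + (ENNReal.ofReal (M / l₀ * Real.exp (l₁ * Real.exp (3 / (1 / 60 / 32))) * Real.exp (-L))
        + (ENNReal.ofReal (Real.exp (-((c - 1) * L)))
        + ENNReal.ofReal ((K + 1) ^ 2 * (1 + l₁) ^ K * 2 ^ (K * K) * (K * K) / l₀
            * ((1 + M * L) ^ K * Real.exp (-(1 / 2) * L)))))) := by
  have hsub : {b : Links n m | ¬ IsTypical b L (1 / 60) (M * Real.exp (2 * l₁) + 2)} ⊆
      {b | ¬ LocallySparse b K}
      ∪ ({b | ∃ v, ¬ (deg (interGraph b) v : ℝ) ≤ (M * Real.exp (2 * l₁) + 2) * L}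
      ∪ ({b | ∃ w, ¬ ((Finset.univ.filter fun v => b (v, w) = true).card : ℝ) ≤ 1 / 60 / 32 * L}
      ∪ ({b | ∃ v, ¬ 0 < deg (interGraph b) v}
      ∪ {b | ∃ u v, u ≠ v ∧ (sharedAttrs b u : ℝ) < 1 / 60 * L ∧
          (sharedAttrs b v : ℝ) < 1 / 60 * L ∧ (interGraph b).edist u v ≤ 10}))) := by
    intro b hb
    by_contra hcon
    simp only [Set.mem_union, not_or, Set.mem_ofPred_eq, not_not, not_exists, not_and, not_le]
      at hcon
    obtain ⟨h1, h2, h3, h4, h5⟩ := hcon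
    refine hb ⟨hK' ▸ h1, fun v => not_lt.1 (h2 v), fun w => ?_, h4, h5⟩
    convert not_lt.1 (h3 w)
  refine (measure_mono hsub).trans ((measure_union_le _ _).trans (add_le_add
    (linkLaw_not_sparse_le hL hnp hmp K) ((measure_union_le _ _).trans (add_le_add
    (linkLaw_exists_deg_gt_le hL hnp hmp) ((measure_union_le _ _).trans (add_le_add
    (linkLaw_exists_attr_gt_le hL (by linarith) hl₀ hnp₀ hnp hM0 hmp (by norm_num))
    ((measure_union_le _ _).trans (add_le_add (linkLaw_exists_isolated_le hL hthr)
    (linkLaw_not_separated_le hL hL0 hc hl₀ hnp₀ hnp hp1 hMp hmp hthr hK hK'.le)))))))))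

lemma tendsto_poly_mul_exp_neg {M : ℝ} (hM : 0 ≤ M) (K : ℕ) {a : ℝ} (ha : 0 < a) :
    Tendsto (fun x : ℝ => (1 + M * x) ^ K * Real.exp (-a * x)) atTop (𝓝 0) := by
  have h1 : Tendsto (fun x : ℝ => ((1 + M) / a) ^ K * ((a * x) ^ K * Real.exp (-(a * x)))) atTop
      (𝓝 (((1 + M) / a) ^ K * 0)) :=
    ((Real.tendsto_pow_mul_exp_neg_atTop_nhds_zero K).comp
      (tendsto_id.const_mul_atTop ha)).const_mul _
  rw [mul_zero] at h1
  refine tendsto_of_tendsto_of_tendsto_of_le_of_le' tendsto_const_nhds h1 ?_ ?_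
  · filter_upwards [eventually_ge_atTop 0] with x hx
    positivity
  · filter_upwards [eventually_ge_atTop 1] with x hx
    have h2 : 0 ≤ x := by linarith
    rw [← mul_assoc, ← mul_pow, neg_mul]
    have h3 : (1 + M) / a * (a * x) = (1 + M) * x := by field_simp
    rw [h3]
    gcongr
    linarith

/-- With high probability the random bipartite graph is typical. -/
lemma tendsto_linkLaw_not_isTypical
    (n m : ℕ → ℕ) (p : ℕ → unitInterval) (c : ℕ → ℝ) (hn : Tendsto n atTop atTop)
    (hc : ∀ k, 1 < c k) (hnp : (fun k => (n k : ℝ) * (p k : ℝ)) =Θ[atTop] fun _ => (1 : ℝ))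
    (hcO : c =O[atTop] fun _ => (1 : ℝ))
    (hthr : ∀ k, (m k : ℝ) * (p k : ℝ) * (1 - (1 - (p k : ℝ)) ^ (n k - 1))
      = c k * Real.log (n k))
    (hcInf : Tendsto (fun k => (c k - 1) * Real.log (n k)) atTop atTop) :
    ∃ Δ : ℝ, 0 < Δ ∧ Tendsto (fun k => linkLaw (n k) (m k) (p k)
      {b | ¬ IsTypical b (Real.log (n k)) (1 / 60) Δ}) atTop (𝓝 0) := by
  have hnR : Tendsto (fun k => (n k : ℝ)) atTop atTop := tendsto_natCast_atTop_atTop.comp hn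
  have hLtop : Tendsto (fun k => Real.log (n k)) atTop atTop := Real.tendsto_log_atTop.comp hnR
  obtain ⟨l₁, hl₁, hnp₁⟩ := hnp.1.exists_pos
  obtain ⟨l, hl, hnp₀⟩ := hnp.2.exists_pos
  obtain ⟨c₁, hc₁, hcc⟩ := hcO.exists_pos
  have hnp₁' : ∀ᶠ k in atTop, (n k : ℝ) * p k ≤ l₁ := by
    filter_upwards [hnp₁.bound] with k hk
    rw [norm_one, mul_one] at hk
    exact (le_abs_self _).trans hk
  have hnp₀' : ∀ᶠ k in atTop, l⁻¹ ≤ (n k : ℝ) * p k := by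
    filter_upwards [hnp₀.bound] with k hk
    have h0 : (0 : ℝ) ≤ n k * p k := mul_nonneg (Nat.cast_nonneg _) (p k).2.1
    rw [norm_one, Real.norm_of_nonneg h0] at hk
    rw [inv_eq_one_div, div_le_iff₀ hl, mul_comm]
    exact hk
  have hcc' : ∀ᶠ k in atTop, c k ≤ c₁ := by
    filter_upwards [hcc.bound] with k hk
    rw [norm_one, mul_one] at hk
    exact (le_abs_self _).trans hk
  have hp0 : Tendsto (fun k => (p k : ℝ)) atTop (𝓝 0) := by
    have h1 : Tendsto (fun k => l₁ / (n k : ℝ)) atTop (𝓝 0) := hnR.const_div_atTop l₁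
    refine tendsto_of_tendsto_of_tendsto_of_le_of_le' tendsto_const_nhds h1
      (Eventually.of_forall fun k => (p k).2.1) ?_
    filter_upwards [hnp₁', hnR.eventually_gt_atTop 0] with k hk hnk
    rw [le_div_iff₀ hnk, mul_comm]
    exact hk
  set l₀ := l⁻¹ with hl₀def
  have hl₀ : 0 < l₀ := inv_pos.2 hl
  -- A lower bound for 1 − (1 − p)^(n−1), since eventually p(n − 1) ≥ l₀ − p ≥ l₀/2. The threshold
  -- equation and c = O(1) then give mp ≤ ML with M = c₁/g.
  set g := 1 - Real.exp (-(l₀ / 2)) with hg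
  have hg0 : 0 < g := by
    have : Real.exp (-(l₀ / 2)) < 1 := by rw [← Real.exp_zero]; exact Real.exp_lt_exp.2 (by linarith)
    linarith
  set M := c₁ / g with hM
  have hM0 : 0 ≤ M := (div_pos hc₁ hg0).le
  have hsmall : ∀ a : ℝ, 0 < a → ∀ᶠ k in atTop, (p k : ℝ) ≤ a := fun a ha =>
    (hp0.eventually (gt_mem_nhds ha)).mono fun k hk => hk.le
  have hMp : ∀ᶠ k in atTop, M * (p k : ℝ) ≤ 1 / 100 := by
    have : Tendsto (fun k => M * (p k : ℝ)) atTop (𝓝 0) := by simpa using hp0.const_mul M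
    exact (this.eventually (gt_mem_nhds (by norm_num : (0 : ℝ) < 1 / 100))).mono fun k hk => hk.le
  have hmp : ∀ᶠ k in atTop, (m k : ℝ) * p k ≤ M * Real.log (n k) := by
    filter_upwards [hsmall (l₀ / 2) (by linarith), hnp₀', hcc', hLtop.eventually_ge_atTop 0,
      hn.eventually_ge_atTop 1] with k hk1 hk2 hk3 hk4 hk5
    have h1 : (1 - (p k : ℝ)) ^ (n k - 1) ≤ Real.exp (-(l₀ / 2)) := by
      refine (one_sub_pow_le_exp (p k).2.2 _).trans (Real.exp_le_exp.2 ?_)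
      rw [Nat.cast_sub hk5]
      push_cast
      linarith
    have h0 : (0 : ℝ) ≤ m k * p k := mul_nonneg (Nat.cast_nonneg _) (p k).2.1
    rw [hM, div_mul_eq_mul_div, le_div_iff₀ hg0]
    calc (m k : ℝ) * p k * g ≤ m k * p k * (1 - (1 - (p k : ℝ)) ^ (n k - 1)) := by
          gcongr; linarith
      _ = c k * Real.log (n k) := hthr k
      _ ≤ c₁ * Real.log (n k) := by gcongr
  refine ⟨M * Real.exp (2 * l₁) + 2, by positivity, ?_⟩
  obtain ⟨K, hK⟩ : ∃ K, K = 40 := ⟨40, rfl⟩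
  have e1 : Tendsto (fun k => Real.exp (-Real.log (n k))) atTop (𝓝 0) :=
    Real.tendsto_exp_neg_atTop_nhds_zero.comp hLtop
  have e2 : Tendsto (fun k => Real.exp (-((c k - 1) * Real.log (n k)))) atTop (𝓝 0) :=
    Real.tendsto_exp_neg_atTop_nhds_zero.comp hcInf
  have e3 : Tendsto (fun k => (1 + M * Real.log (n k)) ^ K * Real.exp (-Real.log (n k))) atTop
      (𝓝 0) := by
    have := (tendsto_poly_mul_exp_neg hM0 K one_pos).comp hLtop
    simpa only [Function.comp_def, neg_mul, one_mul] using this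
  have e4 : Tendsto (fun k => (1 + M * Real.log (n k)) ^ K * Real.exp (-(1 / 2) * Real.log (n k)))
      atTop (𝓝 0) := (tendsto_poly_mul_exp_neg hM0 K one_half_pos).comp hLtop
  have hofReal : ∀ (a : ℝ) {f : ℕ → ℝ}, Tendsto f atTop (𝓝 0) →
      Tendsto (fun k => ENNReal.ofReal (a * f k)) atTop (𝓝 0) := by
    intro a f hf
    have := ENNReal.tendsto_ofReal (hf.const_mul a)
    rwa [mul_zero, ENNReal.ofReal_zero] at this
  have e1' := hofReal 1 e1
  have e2' := hofReal 1 e2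
  simp only [one_mul] at e1' e2'
  have hsum := (hofReal ((K + 1) ^ 2 * (1 + l₁) ^ K * 2 ^ (K * K) * l₁) e3).add (e1'.add
    ((hofReal (M / l₀ * Real.exp (l₁ * Real.exp (3 / (1 / 60 / 32)))) e1).add (e2'.add
    (hofReal ((K + 1) ^ 2 * (1 + l₁) ^ K * 2 ^ (K * K) * (K * K) / l₀) e4))))
  simp only [add_zero] at hsum
  refine tendsto_of_tendsto_of_tendsto_of_le_of_le' tendsto_const_nhds hsum
    (Eventually.of_forall fun _ => zero_le) ?_
  filter_upwards [hnp₁', hnp₀', hsmall (1 / 100) (by norm_num), hMp, hmp,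
    hLtop.eventually_ge_atTop 20, hnR.eventually_gt_atTop 0] with k h1 h2 h3 h4 h5 h6 h7
  exact linkLaw_not_isTypical_le (Real.exp_log h7) h6 (hc k).le hl₀ h2 h1 h3 hM0 h4 h5 (hthr k)
    (by omega) hK

end Typicality

end IntersectionWalk

/-! ### Conclusion: the estimates hold on the typical event -/

open IntersectionWalk in
theorem lemma4
    (n m : ℕ → ℕ) (p : ℕ → unitInterval) (c : ℕ → ℝ)
    (hn : Tendsto n atTop atTop) (hm : Tendsto m atTop atTop)
    (hp : ∀ k, 0 < (p k : ℝ)) (hc : ∀ k, 1 < c k)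
    (hnp : (fun k => (n k : ℝ) * (p k : ℝ)) =Θ[atTop] fun _ => (1 : ℝ))
    (hcO : c =O[atTop] fun _ => (1 : ℝ))
    (hthr : ∀ k, (m k : ℝ) * (p k : ℝ) * (1 - (1 - (p k : ℝ)) ^ (n k - 1))
      = c k * Real.log (n k))
    (hcInf : Tendsto (fun k => (c k - 1) * Real.log (n k)) atTop atTop)
    (T : ℕ → ℕ) (hT : Tendsto T atTop atTop)
    (hTo : (fun k => (T k : ℝ)) =o[atTop] fun k => Real.log (n k) ^ 3)
    (C₀ : ℝ) (hC₀ : 0 < C₀) :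
    ∃ C : ℝ, 0 < C ∧
      Tendsto (fun k => linkLaw (n k) (m k) (p k)
        {b : Links (n k) (m k) |
          -- estimates for a single vertex
          (∀ v : Fin (n k),
            (∀ z : ℂ, ‖z‖ ≤ 1 + (C₀ * T k)⁻¹ →
              |‖returnGF (interGraph b) (T k) v z‖ - 1| ≤ C / Real.log (n k)) ∧
            C⁻¹ / Real.log (n k) ≤ firstReturnProb (interGraph b) (T k) v ∧
            firstReturnProb (interGraph b) (T k) v ≤ C / Real.log (n k) ∧
            ‖returnGF (interGraph b) (T k) v 1
                - (1 + (firstReturnProb (interGraph b) (T k) v : ℂ))‖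
              ≤ C / Real.log (n k) ^ 2) ∧
          -- estimates for a merged pair of distant vertices
          (∀ x y : Fin (n k), 20 ≤ (interGraph b).edist x y →
            (∀ z : ℂ, ‖z‖ ≤ 1 + (C₀ * T k)⁻¹ →
              |‖returnGF (mergedGraph (interGraph b) x y) (T k) (mergedPoint x y) z‖ - 1|
                ≤ C / Real.log (n k)) ∧
            C⁻¹ / Real.log (n k) ≤
              firstReturnProb (mergedGraph (interGraph b) x y) (T k) (mergedPoint x y) ∧
            firstReturnProb (mergedGraph (interGraph b) x y) (T k) (mergedPoint x y)
              ≤ C / Real.log (n k) ∧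
            ‖returnGF (mergedGraph (interGraph b) x y) (T k) (mergedPoint x y) 1
                - (1 + (firstReturnProb (mergedGraph (interGraph b) x y) (T k)
                    (mergedPoint x y) : ℂ))‖
              ≤ C / Real.log (n k) ^ 2 ∧
            |((deg (interGraph b) x : ℝ) + deg (interGraph b) y)
                / (1 + firstReturnProb (mergedGraph (interGraph b) x y) (T k) (mergedPoint x y))
              - ((deg (interGraph b) x : ℝ)
                    / (1 + firstReturnProb (interGraph b) (T k) x)
                  + (deg (interGraph b) y : ℝ)
                    / (1 + firstReturnProb (interGraph b) (T k) y))|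
              ≤ C * ((deg (interGraph b) x : ℝ) + deg (interGraph b) y)
                / Real.log (n k) ^ 2)})
        atTop (𝓝 1) := by
  obtain ⟨Δ, hΔ, hlim⟩ := tendsto_linkLaw_not_isTypical n m p c hn hc hnp hcO hthr hcInf
  have hLtop : Tendsto (fun k => Real.log (n k)) atTop atTop :=
    Real.tendsto_log_atTop.comp (tendsto_natCast_atTop_atTop.comp hn)
  -- The value ε = 1/60 keeps the Laplace factor for the pair at e^{3 · 2L/60} = e^{L/10}, small
  -- enough for the separation bound.
  obtain ⟨Q, hQ⟩ : ∃ Q : ℝ, Q = 266 / (1 / 60) + 2 * (64 / (1 / 60)) ^ 5 := ⟨_, rfl⟩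
  have hQ0 : 0 < Q := by rw [hQ]; norm_num
  obtain ⟨C, hC⟩ : ∃ C : ℝ, C = Δ + Real.exp C₀⁻¹ * (2 * Q) + 2 * Q ^ 2 + Q := ⟨_, rfl⟩
  refine ⟨C, by rw [hC]; positivity, ?_⟩
  have hTL : ∀ᶠ k in atTop, (T k : ℝ) ≤ Real.log (n k) ^ 3 := by
    filter_upwards [hTo.bound one_pos, hLtop.eventually_ge_atTop 0] with k hk hL
    rwa [one_mul, Real.norm_of_nonneg (Nat.cast_nonneg _), Real.norm_of_nonneg (by positivity)] at hk
  have hlim' : Tendsto (fun k => 1 - linkLaw (n k) (m k) (p k)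
      {b | ¬ IsTypical b (Real.log (n k)) (1 / 60) Δ}) atTop (𝓝 1) := by
    have := ENNReal.Tendsto.sub (tendsto_const_nhds (x := (1 : ENNReal))) hlim
      (Or.inl ENNReal.one_ne_top)
    rwa [tsub_zero] at this
  have hprob : ∀ k, IsProbabilityMeasure (linkLaw (n k) (m k) (p k)) := fun k => by
    unfold linkLaw; infer_instance
  refine tendsto_of_tendsto_of_tendsto_of_le_of_le' hlim' tendsto_const_nhds ?_
    (Eventually.of_forall fun k => prob_le_one)
  filter_upwards [hTL, hT.eventually_ge_atTop 3, hLtop.eventually_ge_atTop 1,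
    hLtop.eventually_ge_atTop (2 * Q)] with k h1 h2 h3 h4
  rw [← prob_compl_eq_one_sub MeasurableSet.of_discrete]
  refine measure_mono fun b hb => ?_
  have hb' : IsTypical b (Real.log (n k)) (1 / 60) Δ := by
    by_contra h
    exact hb h
  exact hb'.estimates (by norm_num) hΔ hQ h3 h4 h2 h1 hC₀ hC
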